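/- **Setup.** Let $M=\{m_{ij} : i,j\in\mathbb Z_3\}$, and let $\mathcal C$ consist of the six contexts $C_i^{hor}=\{m_{ij}: j\in\mathbb Z_3\}$ and $C_j^{ver}=\{m_{ij}: i\in\mathbb Z_3\}$. For $\beta:\mathcal C\to\mathbb Z_2$ the Mermin polytope $MP_\beta$ is the set of families $p=(p_C)_{C\in\mathcal C}$ of probability distributions $p_C$ on $\mathbb Z_2^C$ whose marginals agree on the intersections $C\cap C'$ and such that $p_C(s)>0$ implies $\sum_{m\in C}s(m)=\beta(C)$. Let $MP_0$ be the case $\beta=0$, and $MP_1$ the case $\beta=\beta_1$, where $\beta_1=0$ on horizontal and $\beta_1=1$ on vertical contexts. The graph of a polytope has the vertices of the polytope as its vertices; two distinct vertices are neighbors if the segment between them is a face. $N(p)$ is the set of neighbors of $p$. A set $\Omega\subset M$ is closed if it contains every context of which it contains two measurements; an outcome assignment on $\Omega$ is a function $s:\Omega\to\mathbb Z_2$ with $\sum_{m\in C}s(m)=\beta_1(C)$ for all contexts $C\subset\Omega$; $\Omega$ is cnc if it is closed and admits an outcome assignment. A maximal cnc set is of type 1 if it consists of three measurements, no two of which lie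 in a common context, and of type 2 if it is the union of two distinct contexts that share exactly one measurement. A vertex $p$ of $MP_1$ is of type $k$ if there are a maximal cnc set $\Omega$ of type $k$ and an outcome assignment $s$ on it such that the probability of outcome $0$ of the measurement $m$ is $p_m^0=(1+(-1)^{s(m)})/2$ for $m\in\Omega$ and $p_m^0=1/2$ for $m\notin\Omega$. A loop is the edge set $L\subset M$ of a cycle of the graph $K_{3,3}$ that has the contexts as vertices and the measurements as edges ($m_{ij}$ joins $C_i^{hor}$ and $C_j^{ver}$). A signed loop is a loop $L$ with a function $\varphi:L\to\{\pm1\}$, extended by $0$ to $M$; put $p^\varphi_C(s)=\frac12\sum_{m\in C}(-1)^{s(m)}\varphi(m)$ if $\sum_{m\in C}s(m)=\beta_1(C)$ and $p^\varphi_C(s)=0$ otherwise. Let $X,Y,Z$ be the Pauli matrices and $(T_{m_{ij}})$ the square with rows $(X\otimes X,\,Y\otimes Z,\,Z\otimes Y)$, $(Z\otimes Z,\,X\otimes Y,\,Y\otimes X)$, $(Y\otimes Y,\,Z\otimes X,\,X\otimes Z)$. To $p\in MP_1$ assign the operator $\rho_p=\frac14\bigl(1+\sum_{m\in M}(p_m^0-p_m^1)\,T_m\bigr)$.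 Let $G_1$ be the group of two-qubit unitaries modulo phases generated by all $U\otimes V$, with $U,V$ one-qubit Clifford unitaries, and by SWAP; it acts on operators by conjugation. **Theorem.** 1. The graph of $MP_0$ is the complete graph $K_{16}$. 2. For the graph of $MP_1$ the following hold. * The map $p\mapsto\rho_p$ is injective on $MP_1$ and its image is invariant under $G_1$. (So $G_1$ acts on $MP_1$; points and operators are identified below.) * $MP_1$ has $120$ vertices; each is of exactly one of the types 1 and 2; $48$ are of type 1 and $72$ of type 2. * If $q_1,q_2$ are neighboring vertices, there is a signed loop $\varphi$ such that the edge between them is $\{q_1+\alpha p^\varphi : 0\le\alpha\le 1/2\}$, with $q_1+\frac12p^\varphi=q_2$. * If $q$ is a vertex of type 1, then $N(q)$ consists of $12$ vertices, all of type 2, and they form a single orbit of $\mathrm{Stab}_{G_1}(q)$. * If $p$ is a vertex of type 2, then $N(p)$ contains exactly $8$ vertices of type 1, which form a single orbit of $\mathrm{Stab}_{G_1}(p)$, and exactly $16$ vertices of type 2, which form two orbits of $\mathrm{Stab}_{G_1}(p)$ of size $8$ each. * The operators $q_0=\frac14(1+X\otimes Y-Y\otimes Y+Z\otimes Y)$ and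 $q_1=\frac14(1+Z\otimes X-Z\otimes Y+Z\otimes Z)$ are vertices of type 1, and $p_0=\frac14(1+X\otimes X+X\otimes Y+Y\otimes X-Y\otimes Y+Z\otimes Z)$, $p_1=\frac14(1+X\otimes X+X\otimes Y-Y\otimes Z+Z\otimes X-Z\otimes Y)$, $p_2=\frac14(1+X\otimes X-Y\otimes Y-Y\otimes Z-Z\otimes Y+Z\otimes Z)$ are vertices of type 2. $N(q_0)$ is the $\mathrm{Stab}_{G_1}(q_0)$-orbit of $p_0$; the type 1 part of $N(p_0)$ is the $\mathrm{Stab}_{G_1}(p_0)$-orbit of $q_0$, and its type 2 part is the disjoint union of the $\mathrm{Stab}_{G_1}(p_0)$-orbits of $p_1$ and $p_2$. Moreover $q_1\notin N(p_0)$, although $q_1=p_0+\frac12p^\varphi$ for some signed loop $\varphi$. -/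

import Mathlib

open scoped Kronecker

noncomputable section

namespace Mermin

/-! ### The Mermin scenario and its polytopes -/

/-- The nine measurements `m_{ij}`. -/
abbrev Meas : Type := Fin 3 × Fin 3

/-- The six contexts: `Sum.inl i` is the horizontal context `C_i^hor`,
`Sum.inr j` the vertical context `C_j^ver`. -/
abbrev Ctx : Type := Fin 3 ⊕ Fin 3

/-- The set of measurements that belong to a context. -/
def ctx : Ctx → Finset Meas
  | Sum.inl i => Finset.univ.filter fun m => m.1 = i
  | Sum.inr j => Finset.univ.filter fun m => m.2 = j

/-- Functions `U → ℤ₂`. -/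
abbrev Assign (U : Finset Meas) : Type := {m : Meas // m ∈ U} → ZMod 2

/-- The ambient real vector space of families `(p_C)_C` of functions `p_C : ℤ₂^C → ℝ`. -/
abbrev Dist : Type := (C : Ctx) → Assign (ctx C) → ℝ

/-- Restriction of functions to a smaller set of measurements. -/
def restrict {U V : Finset Meas} (h : V ⊆ U) (s : Assign U) : Assign V :=
  fun m => s ⟨m.1, h m.2⟩

/-- Marginalization of a function on `ℤ₂^U` to `ℤ₂^V`. -/
def marginal {U V : Finset Meas} (h : V ⊆ U) (f : Assign U → ℝ) : Assign V → ℝ :=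
  fun t => ∑ s with restrict h s = t, f s

/-- The nonsignaling polytope of the Mermin scenario. -/
def NS : Set Dist :=
  {p | (∀ C s, 0 ≤ p C s) ∧ (∀ C, ∑ s, p C s = 1) ∧
    ∀ C C' : Ctx,
      marginal (Finset.inter_subset_left : ctx C ∩ ctx C' ⊆ ctx C) (p C) =
        marginal (Finset.inter_subset_right : ctx C ∩ ctx C' ⊆ ctx C') (p C')}

/-- The Mermin polytope `MP_β`: the support of each `p_C` consists of functions whose
values add up to `β C`. -/
def MP (β : Ctx → ZMod 2) : Set Dist :=
  {p | p ∈ NS ∧ ∀ C s, 0 < p C s → ∑ m, s m = β C}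

/-- The even case. -/
def beta0 : Ctx → ZMod 2 := fun _ => 0

/-- The odd case: `0` on horizontal and `1` on vertical contexts. -/
def beta1 : Ctx → ZMod 2
  | Sum.inl _ => 0
  | Sum.inr _ => 1

/-! ### The graph of a polytope -/

/-- The graph of a polytope `P`: its vertices are the extreme points of `P`, and two distinct
vertices are neighbors if the segment between them is a face of `P`. -/
def polytopeGraph {E : Type} [AddCommGroup E] [Module ℝ E] [TopologicalSpace E] (P : Set E) :
    SimpleGraph (P.extremePoints ℝ) where
  Adj v w := v ≠ w ∧ IsExposed ℝ P (segment ℝ (v : E) (w : E))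
  symm := ⟨fun v w h => ⟨h.1.symm, by rw [segment_symm]; exact h.2⟩⟩
  loopless := ⟨fun _ h => h.1 rfl⟩

/-- The vertices of `MP_1`. -/
abbrev Vertex : Type := (MP beta1).extremePoints ℝ

/-- The set `N(p)` of neighbors of a vertex `p` of `MP_1`. -/
def N (p : Vertex) : Set Vertex := (polytopeGraph (MP beta1)).neighborSet p

/-! ### Closed noncontextual sets and the two types of vertices -/

/-- The sign `(-1)^a`. -/
def sgn (a : ZMod 2) : ℝ := (-1) ^ a.val

/-- `Ω` is closed (under inference): with two measurements of a context it contains the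
whole context. -/
def IsClosedSet (Ω : Finset Meas) : Prop :=
  ∀ C : Ctx, ∀ a ∈ ctx C, ∀ b ∈ ctx C, a ≠ b → a ∈ Ω → b ∈ Ω → ctx C ⊆ Ω

/-- Outcome assignments on `Ω` with respect to `β`. -/
def IsOutcome (β : Ctx → ZMod 2) (Ω : Finset Meas) (s : Assign Ω) : Prop :=
  ∀ (C : Ctx) (h : ctx C ⊆ Ω), ∑ m, restrict h s m = β C

/-- Closed noncontextual (cnc) sets. -/
def IsCNC (β : Ctx → ZMod 2) (Ω : Finset Meas) : Prop :=
  IsClosedSet Ω ∧ ∃ s, IsOutcome β Ω s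

/-- Type 1 maximal cnc sets: three measurements, no two of which lie in a common context. -/
def IsType1Set (Ω : Finset Meas) : Prop :=
  Maximal (IsCNC beta1) Ω ∧ Ω.card = 3 ∧
    ∀ a ∈ Ω, ∀ b ∈ Ω, a ≠ b → ¬ ∃ C, a ∈ ctx C ∧ b ∈ ctx C

/-- Type 2 maximal cnc sets: the union of two distinct contexts that share one measurement. -/
def IsType2Set (Ω : Finset Meas) : Prop :=
  Maximal (IsCNC beta1) Ω ∧
    ∃ C C' : Ctx, C ≠ C' ∧ (ctx C ∩ ctx C').card = 1 ∧ Ω = ctx C ∪ ctx C'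

/-- `p_m^a`, the probability of the outcome `a` of the measurement `m`, computed in `C ∋ m`. -/
def prob (p : Dist) (C : Ctx) (m : {m : Meas // m ∈ ctx C}) (a : ZMod 2) : ℝ :=
  ∑ s with s m = a, p C s

/-- The single-measurement marginals of `p` are the deterministic ones given by `s` on `Ω`, and
uniform outside `Ω`. -/
def HasMarginals (p : Dist) (Ω : Finset Meas) (s : Assign Ω) : Prop :=
  ∀ (C : Ctx) (m : {m : Meas // m ∈ ctx C}),
    (∀ h : m.1 ∈ Ω, prob p C m 0 = (1 + sgn (s ⟨m.1, h⟩)) / 2) ∧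
      (m.1 ∉ Ω → prob p C m 0 = 1 / 2)

/-- The vertices of type 1. -/
def Type1 : Set Vertex :=
  {p | ∃ (Ω : Finset Meas) (s : Assign Ω), IsType1Set Ω ∧ IsOutcome beta1 Ω s ∧
    HasMarginals p.1 Ω s}

/-- The vertices of type 2. -/
def Type2 : Set Vertex :=
  {p | ∃ (Ω : Finset Meas) (s : Assign Ω), IsType2Set Ω ∧ IsOutcome beta1 Ω s ∧
    HasMarginals p.1 Ω s}

/-! ### Signed loops -/

/-- `L` is the set of measurements on a loop, that is, the edge set of a cycle in the graph
`K_{3,3}` whose vertices are the contexts and whose edges are the measurements; `m_{ij}` joins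
`C_i^hor` and `C_j^ver`. -/
def IsLoop (L : Finset Meas) : Prop :=
  ∃ (C : Ctx) (w : (completeBipartiteGraph (Fin 3) (Fin 3)).Walk C C),
    w.IsCycle ∧ ∀ m : Meas, m ∈ L ↔ s(Sum.inl m.1, Sum.inr m.2) ∈ w.edges

/-- The direction `p^φ` of a signed loop `φ : L → {±1}`: on the function
`(x, y, z) ↦ (a, b, c)` with `a + b + c = β₁(C)` on `C = {x, y, z}` its value is
`((-1)^a φ(x) + (-1)^b φ(y) + (-1)^c φ(z)) / 2`, where `φ` is `0` outside `L`. -/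
def loopDir (L : Finset Meas) (φ : {m : Meas // m ∈ L} → ℤˣ) : Dist :=
  fun C s =>
    if ∑ m, s m = beta1 C then
      (∑ m, sgn (s m) * (if h : m.1 ∈ L then (((φ ⟨m.1, h⟩ : ℤˣ) : ℤ) : ℝ) else 0)) / 2
    else 0

/-! ### Points of `MP_1` as two-qubit operators -/

/-- One-qubit operators. -/
abbrev Op1 : Type := Matrix (Fin 2) (Fin 2) ℂ

/-- Two-qubit operators. -/
abbrev Op2 : Type := Matrix (Fin 2 × Fin 2) (Fin 2 × Fin 2) ℂ

/-- The Pauli matrix `X`. -/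
def X : Op1 := !![0, 1; 1, 0]

/-- The Pauli matrix `Y`. -/
def Y : Op1 := !![0, -Complex.I; Complex.I, 0]

/-- The Pauli matrix `Z`. -/
def Z : Op1 := !![1, 0; 0, -1]

/-- The Mermin square of nonlocal Pauli operators: the operators in each row and each column
commute, each row has product `1` and each column has product `-1`. -/
def pauliSquare : Matrix (Fin 3) (Fin 3) Op2 :=
  !![X ⊗ₖ X, Y ⊗ₖ Z, Z ⊗ₖ Y;
     Z ⊗ₖ Z, X ⊗ₖ Y, Y ⊗ₖ X;
     Y ⊗ₖ Y, Z ⊗ₖ X, X ⊗ₖ Z]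

/-- The expectation value `p_m^0 - p_m^1`, computed in the horizontal context of `m`. -/
def expect (p : Dist) (m : Meas) : ℝ :=
  prob p (Sum.inl m.1) ⟨m, by simp [ctx]⟩ 0 - prob p (Sum.inl m.1) ⟨m, by simp [ctx]⟩ 1

/-- The operator `ρ_p` of a distribution `p`. -/
def toOp (p : Dist) : Op2 :=
  (1 / 4 : ℂ) • (1 + ∑ m : Meas, (expect p m : ℂ) • pauliSquare m.1 m.2)

/-- The operators of a set of vertices. -/
def toOps (S : Set Vertex) : Set Op2 := (fun p : Vertex => toOp p.1) '' S

/-! ### The symmetry group `G_1` -/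

/-- The one-qubit Pauli group. -/
def pauliGroup : Set Op1 :=
  {A | ∃ k : ℕ, ∃ B ∈ ({1, X, Y, Z} : Set Op1), A = Complex.I ^ k • B}

/-- The one-qubit Clifford unitaries. -/
def IsClifford (U : Op1) : Prop :=
  U ∈ Matrix.unitaryGroup (Fin 2) ℂ ∧ ∀ A ∈ pauliGroup, U * A * star U ∈ pauliGroup

/-- The swap of the two qubits. -/
def swapOp : Op2 := Matrix.of fun x y => if x = y.swap then 1 else 0

/-- The conjugation `A ↦ U A U†` by a unitary; its kernel consists of the phases `e^{iθ} 1`. -/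
def conj : Matrix.unitaryGroup (Fin 2 × Fin 2) ℂ →* (Op2 ≃ₐ[ℂ] Op2) where
  toFun U := (Unitary.conjStarAlgAut ℂ Op2 U).toAlgEquiv
  map_one' := by ext1 A; simp
  map_mul' U V := by ext1 A; simp [mul_assoc]

/-- The group `G_1 = ⟨Cl_1 × Cl_1, SWAP⟩` of unitaries modulo phases, a unitary modulo phases
being given as the conjugation by it. -/
def G1 : Subgroup (Op2 ≃ₐ[ℂ] Op2) :=
  (Subgroup.closure {g : Matrix.unitaryGroup (Fin 2 × Fin 2) ℂ |
    (∃ U V : Op1, IsClifford U ∧ IsClifford V ∧ (g : Op2) = U ⊗ₖ V) ∨ (g : Op2) = swapOp}).map conj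

/-- The orbit of the operator of `r` under the stabilizer in `G_1` of the operator of `p`. -/
def stabOrbit (p r : Vertex) : Set Op2 :=
  MulAction.orbit (MulAction.stabilizer G1 (toOp p.1)) (toOp r.1)

end Mermin

end

/-!
A point of `MP_β` is determined by its nine expectation values, because on each context the parity
condition leaves four outcomes. So `MP_β` is affinely isomorphic to the polytope of the `e ∈ ℝ⁹`
with `∑ₖ (-1)^(s k) e_{m_k} ≥ -1` for all contexts `{m₀, m₁, m₂}` and outcomes `s` of parity `β`.

If `|e_m| = 1` for a measurement `m`, the other two measurements of each context of `m` are equal up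
to a sign, and otherwise at most one inequality of a context is tight. Counting the linear
conditions that the tight inequalities impose, at least nine at an extreme point, shows that the
deterministic measurements of an extreme point are the graph of a permutation, the union of a row
and a column, or everything. For `β = 0` this forces the sixteen deterministic points; two of them
differ on the support of a loop, and on the common facets all values along this loop are
proportional. For `β₁` the last case is impossible, and the sign changes along the loop of the
remaining measurements add up to an odd number, so that the remaining values vanish. This gives the
48 + 72 vertices, which have integral vectors of squared norms 3 and 5.

Up to signs and order, Clifford unitaries permute the Pauli matrices, so the elements of `G₁` act on
`ℝ⁹` by signed permutations that come from two rotations of the cube and the exchange of the qubits.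
Modulo them there is one vertex of each type. Two distinct vertices are neighbors exactly if their
scalar product is 2 or 3: the common tight inequalities of such a pair single out the segment, and
for any other pair `v ≠ w` the polytope contains `v + w - u` for a third vertex `u`, so that the
midpoint of `v` and `w` is also the midpoint of two points outside of the segment. The orbits of the
stabilizer of a vertex on its neighbors are separated by their squared norms and the scalar products
with it.
-/

open scoped Kronecker

noncomputable section

namespace Mermin

/-! ### Polyhedra and affine embeddings -/

section Polyhedron

variable {E ι : Type*} [AddCommGroup E] [Module ℝ E] [TopologicalSpace E]
  {ℓ : ι → E →L[ℝ] ℝ} {b : ι → ℝ} {v w x : E}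

/-- The polyhedron of the solutions `x` of the linear inequalities `b i ≤ ℓ i x`. -/
def polyhedron (ℓ : ι → E →L[ℝ] ℝ) (b : ι → ℝ) : Set E := {x | ∀ i, b i ≤ ℓ i x}

theorem convex_polyhedron : Convex ℝ (polyhedron ℓ b) := by
  simp only [polyhedron, Set.ofPred_forall]
  exact convex_iInter fun i => convex_halfSpace_ge (ℓ i).isLinear _

theorem isClosed_polyhedron : IsClosed (polyhedron ℓ b) := by
  simp only [polyhedron, Set.ofPred_forall]
  exact isClosed_iInter fun i => isClosed_le continuous_const (ℓ i).continuous

theorem isExposed_setOf_tight [Finite ι] (I : Set ι) :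
    IsExposed ℝ (polyhedron ℓ b) {x ∈ polyhedron ℓ b | ∀ i ∈ I, ℓ i x = b i} := by
  classical
  have := Fintype.ofFinite ι
  rintro ⟨v, hvP, hv⟩
  refine ⟨-∑ i with i ∈ I, ℓ i, Set.ext fun x => and_congr_right fun hx => ?_⟩
  have hle {y : E} (hy : y ∈ polyhedron ℓ b) : ∑ i with i ∈ I, b i ≤ ∑ i with i ∈ I, ℓ i y :=
    Finset.sum_le_sum fun i _ => hy i
  have heq {y : E} (hy : ∀ i ∈ I, ℓ i y = b i) :
      ∑ i with i ∈ I, ℓ i y = ∑ i with i ∈ I, b i :=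
    Finset.sum_congr rfl fun i hi => hy i (Finset.mem_filter.1 hi).2
  simp only [neg_apply, sum_apply, neg_le_neg_iff]
  refine ⟨fun h y hy => (heq h).trans_le (hle hy), fun h i hi => ?_⟩
  have hsum : ∑ i with i ∈ I, b i = ∑ i with i ∈ I, ℓ i x :=
    (hle hx).antisymm ((h v hvP).trans_eq (heq hv))
  exact ((Finset.sum_eq_sum_iff_of_le fun i _ => hx i).1 hsum i (by simpa using hi)).symm

theorem segment_subset_setOf_tight (hv : v ∈ polyhedron ℓ b) (hw : w ∈ polyhedron ℓ b) :
    segment ℝ v w ⊆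
      {x ∈ polyhedron ℓ b | ∀ i ∈ {i | ℓ i v = b i ∧ ℓ i w = b i}, ℓ i x = b i} := by
  rintro x ⟨s, t, hs, ht, hst, rfl⟩
  have hb (i : ι) : s * b i + t * b i = b i := by rw [← add_mul, hst, one_mul]
  refine ⟨fun i => ?_, fun i hi => ?_⟩
  · simpa [hb] using
      add_le_add (mul_le_mul_of_nonneg_left (hv i) hs) (mul_le_mul_of_nonneg_left (hw i) ht)
  · simp [hi.1, hi.2, hb]

theorem isExposed_segment_of_tight [Finite ι] (hv : v ∈ polyhedron ℓ b) (hw : w ∈ polyhedron ℓ b)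
    (h : ∀ x ∈ polyhedron ℓ b, (∀ i, ℓ i v = b i → ℓ i w = b i → ℓ i x = b i) →
      x ∈ segment ℝ v w) :
    IsExposed ℝ (polyhedron ℓ b) (segment ℝ v w) := by
  rw [(segment_subset_setOf_tight hv hw).antisymm
    fun x hx => h x hx.1 fun i hiv hiw => hx.2 i ⟨hiv, hiw⟩]
  exact isExposed_setOf_tight _

theorem isExposed_segment_of_extremePoints_tight [Finite ι] [IsTopologicalAddGroup E]
    [ContinuousSMul ℝ E] [LocallyConvexSpace ℝ E] [T2Space E]
    (hP : IsCompact (polyhedron ℓ b)) (hv : v ∈ polyhedron ℓ b) (hw : w ∈ polyhedron ℓ b)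
    (h : ∀ x ∈ (polyhedron ℓ b).extremePoints ℝ,
      (∀ i, ℓ i v = b i → ℓ i w = b i → ℓ i x = b i) → x = v ∨ x = w) :
    IsExposed ℝ (polyhedron ℓ b) (segment ℝ v w) := by
  have hF : IsExposed ℝ (polyhedron ℓ b)
      {x ∈ polyhedron ℓ b | ∀ i ∈ {i | ℓ i v = b i ∧ ℓ i w = b i}, ℓ i x = b i} :=
    isExposed_setOf_tight _
  refine isExposed_segment_of_tight hv hw fun x hx hxvw => ?_
  have hext : Set.extremePoints ℝ {x ∈ polyhedron ℓ b |
      ∀ i ∈ {i | ℓ i v = b i ∧ ℓ i w = b i}, ℓ i x = b i} ⊆ {v, w} := fun y hy =>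
    h y (hF.isExtreme.extremePoints_subset_extremePoints hy) fun i hiv hiw => hy.1.2 i ⟨hiv, hiw⟩
  have hx' := (closure_convexHull_extremePoints (hF.isCompact hP)
    (hF.convex convex_polyhedron)).ge ⟨hx, fun i hi => hxvw i hi.1 hi.2⟩
  have hclosed : IsClosed (convexHull ℝ {v, w}) :=
    (Set.toFinite {v, w}).isClosed_convexHull ℝ
  rw [← convexHull_pair]
  exact closure_minimal (convexHull_mono hext) hclosed hx'

theorem mem_extremePoints_of_tight [Finite ι] (hv : v ∈ polyhedron ℓ b)
    (h : ∀ x ∈ polyhedron ℓ b, (∀ i, ℓ i v = b i → ℓ i x = b i) → x = v) :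
    v ∈ (polyhedron ℓ b).extremePoints ℝ := by
  rw [← isExtreme_singleton, ← segment_same ℝ v]
  exact (isExposed_segment_of_tight hv hv fun x hx hxv => by
    rw [h x hx fun i hi => hxv i hi hi]; exact left_mem_segment ℝ v v).isExtreme

theorem eventually_add_smul_mem_polyhedron [Finite ι] (hv : v ∈ polyhedron ℓ b) {d : E}
    (hd : ∀ i, ℓ i v = b i → ℓ i d = 0) : ∀ᶠ ε : ℝ in nhds 0, v + ε • d ∈ polyhedron ℓ b := by
  refine Filter.eventually_all.2 fun i => ?_
  rcases (hv i).eq_or_lt with hi | hi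
  · exact Filter.Eventually.of_forall fun ε => by simp [hd i hi.symm, hi]
  · have hcont : Continuous fun ε : ℝ => ℓ i v + ε * ℓ i d := by fun_prop
    filter_upwards [hcont.tendsto' 0 (ℓ i v) (by simp) |>.eventually_const_lt hi] with ε hε
    simpa using hε.le

theorem eq_zero_of_mem_extremePoints [Finite ι] (hv : v ∈ (polyhedron ℓ b).extremePoints ℝ)
    {d : E} (hd : ∀ i, ℓ i v = b i → ℓ i d = 0) : d = 0 := by
  have hpos := eventually_add_smul_mem_polyhedron hv.1 hd
  have hneg := eventually_add_smul_mem_polyhedron (d := -d) hv.1 fun i hi => by simp [hd i hi]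
  obtain ⟨ε, ⟨hε, hε'⟩, hε0 : 0 < ε⟩ :=
    (((hpos.and hneg).filter_mono nhdsWithin_le_nhds).and
      (self_mem_nhdsWithin (s := Set.Ioi 0))).exists
  have hmem : v ∈ openSegment ℝ (v + ε • d) (v + ε • -d) :=
    ⟨1 / 2, 1 / 2, by norm_num, by norm_num, by norm_num, by module⟩
  have : ε • d = 0 := by simpa using (mem_extremePoints.1 hv).2 _ hε _ hε' hmem |>.1
  exact (smul_eq_zero.1 this).resolve_left hε0.ne'

end Polyhedron

section Extreme

variable {E F : Type*} [AddCommGroup E] [Module ℝ E] [AddCommGroup F] [Module ℝ F]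
  {P B : Set E}

theorem eq_or_eq_of_add_eq_add_of_isExtreme_segment {v w x y : E}
    (h : IsExtreme ℝ P (segment ℝ v w)) (hx : x ∈ P.extremePoints ℝ) (hy : y ∈ P)
    (hxy : x + y = v + w) : x = v ∨ x = w := by
  have hmid : (1 / 2 : ℝ) • (x + y) ∈ segment ℝ v w := by
    rw [hxy]; exact ⟨1 / 2, 1 / 2, by norm_num, by norm_num, by norm_num, by module⟩
  have hxs : x ∈ segment ℝ v w :=
    h.2 hx.1 hy hmid ⟨1 / 2, 1 / 2, by norm_num, by norm_num, by norm_num, by module⟩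
  have := (mem_extremePoints_iff_forall_segment.1 hx).2 v (h.1 (left_mem_segment ℝ v w)) w
    (h.1 (right_mem_segment ℝ v w)) hxs
  exact this.imp Eq.symm Eq.symm

theorem isExtreme_image_iff (f : E →ᵃ[ℝ] F) (hf : Function.Injective f) :
    IsExtreme ℝ (f '' P) (f '' B) ↔ IsExtreme ℝ P B := by
  refine ⟨fun h => ⟨(Set.image_subset_image_iff hf).1 h.1, fun x hx y hy z hz hxy => ?_⟩,
    fun h => ⟨Set.image_mono h.1, ?_⟩⟩
  · exact hf.mem_set_image.1 <| h.2 ⟨x, hx, rfl⟩ ⟨y, hy, rfl⟩ ⟨z, hz, rfl⟩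
      (by rw [← image_openSegment]; exact ⟨z, hxy, rfl⟩)
  · rintro _ ⟨x, hx, rfl⟩ _ ⟨y, hy, rfl⟩ _ ⟨z, hz, rfl⟩ hxy
    rw [← image_openSegment, hf.mem_set_image] at hxy
    exact ⟨x, h.2 hx hy hz hxy, rfl⟩

theorem extremePoints_image (f : E →ᵃ[ℝ] F) (hf : Function.Injective f) :
    (f '' P).extremePoints ℝ = f '' P.extremePoints ℝ := by
  refine Set.Subset.antisymm (fun y hy => ?_) ?_
  · obtain ⟨x, -, rfl⟩ := extremePoints_subset hy
    rw [← isExtreme_singleton, ← Set.image_singleton, isExtreme_image_iff f hf,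
      isExtreme_singleton] at hy
    exact ⟨x, hy, rfl⟩
  · rintro _ ⟨x, hx, rfl⟩
    rwa [← isExtreme_singleton, ← Set.image_singleton, isExtreme_image_iff f hf,
      isExtreme_singleton]

theorem isExposed_image_of_leftInverse [TopologicalSpace E] [TopologicalSpace F]
    (f : E →ᵃ[ℝ] F) (g : F →L[ℝ] E) (hg : Function.LeftInverse g f)
    (h : IsExposed ℝ P B) : IsExposed ℝ (f '' P) (f '' B) := by
  rintro ⟨_, b, hb, rfl⟩
  obtain ⟨l, rfl⟩ := h ⟨b, hb⟩
  refine ⟨l.comp g, ?_⟩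
  ext y
  constructor
  · rintro ⟨x, hx, rfl⟩
    refine ⟨⟨x, hx.1, rfl⟩, ?_⟩
    rintro _ ⟨z, hz, rfl⟩
    simpa [hg _] using hx.2 z hz
  · rintro ⟨⟨x, hx, rfl⟩, hy⟩
    exact ⟨x, ⟨hx, fun z hz => by simpa [hg _] using hy (f z) ⟨z, hz, rfl⟩⟩, rfl⟩

end Extreme

/-- The sign `(-1)^a` as an integer, for statements that are decided by computation. -/
def sgnZ (a : ZMod 2) : ℤ := (-1) ^ a.val

theorem cast_sgnZ (a : ZMod 2) : ((sgnZ a : ℤ) : ℝ) = sgn a := by simp [sgnZ, sgn]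

theorem sgn_zero : sgn 0 = 1 := by simp [sgn]

theorem sgn_one : sgn 1 = -1 := by
  have h : (1 : ZMod 2).val = 1 := by decide
  simp [sgn, h]

theorem zmod2_eq_zero_or_one (a : ZMod 2) : a = 0 ∨ a = 1 := by revert a; decide

theorem sgn_eq_or (a : ZMod 2) : (a = 0 ∧ sgn a = 1) ∨ (a = 1 ∧ sgn a = -1) := by
  rcases zmod2_eq_zero_or_one a with rfl | rfl
  · exact Or.inl ⟨rfl, sgn_zero⟩
  · exact Or.inr ⟨rfl, sgn_one⟩

theorem sgnZ_add (a b : ZMod 2) : sgnZ (a + b) = sgnZ a * sgnZ b := by revert a b; decide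

theorem sgn_add (a b : ZMod 2) : sgn (a + b) = sgn a * sgn b := by
  rw [← cast_sgnZ, sgnZ_add, Int.cast_mul, cast_sgnZ, cast_sgnZ]

theorem sgn_mul_self (a : ZMod 2) : sgn a * sgn a = 1 := by
  rcases sgn_eq_or a with ⟨-, h⟩ | ⟨-, h⟩ <;> simp [h]

theorem sgn_ne_zero (a : ZMod 2) : sgn a ≠ 0 := fun h => by
  simpa [h] using sgn_mul_self a

theorem sgn_injective : Function.Injective sgn := by
  intro a b h
  rcases sgn_eq_or a with ⟨rfl, ha⟩ | ⟨rfl, ha⟩ <;> rcases sgn_eq_or b with ⟨rfl, hb⟩ | ⟨rfl, hb⟩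
  · rfl
  · rw [ha, hb] at h; norm_num at h
  · rw [ha, hb] at h; norm_num at h
  · rfl

theorem exists_sgn_eq {x : ℝ} (h : |x| = 1) : ∃ a, x = sgn a := by
  rcases eq_or_eq_neg_of_abs_eq h with h | h
  · exact ⟨0, by rw [h, sgn_zero]⟩
  · exact ⟨1, by rw [h, sgn_one]⟩

theorem sum_sgnZ_mul_sgnZ : ∀ (C : Ctx) (s t : Assign (ctx C)), ∑ m, s m = ∑ m, t m →
    ∑ m, sgnZ (s m) * sgnZ (t m) = if s = t then 3 else -1 := by
  decide +kernel

theorem card_filter_parity : ∀ (C : Ctx) (b : ZMod 2) (m : {m // m ∈ ctx C}) (a : ZMod 2),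
    (Finset.univ.filter fun s : Assign (ctx C) => s m = a ∧ ∑ m, s m = b).card = 2 := by
  decide +kernel

theorem sum_filter_parity : ∀ (C : Ctx) (b : ZMod 2) (m m' : {m // m ∈ ctx C}) (a : ZMod 2),
    ∑ s : Assign (ctx C) with s m = a ∧ ∑ m, s m = b, sgnZ (s m') =
      if m' = m then 2 * sgnZ a else 0 := by
  decide +kernel

/-! ### Correlation vectors -/

/-- Vectors of expectation values. -/
abbrev Corr : Type := Meas → ℝ

/-- The `k`-th measurement of a context. -/
def ctxMeas : Ctx → Fin 3 → Meas
  | Sum.inl i, k => (i, k)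
  | Sum.inr j, k => (k, j)

theorem ctxMeas_injective (C : Ctx) : Function.Injective (ctxMeas C) := by
  revert C; decide

theorem mem_ctx_iff (C : Ctx) (m : Meas) : m ∈ ctx C ↔ ∃ k, ctxMeas C k = m := by
  revert C m; decide

theorem ctxMeas_mem_ctx (C : Ctx) (k : Fin 3) : ctxMeas C k ∈ ctx C :=
  (mem_ctx_iff C _).2 ⟨k, rfl⟩

/-- The numbering of the measurements of a context. -/
def ctxEquiv (C : Ctx) : Fin 3 ≃ {m : Meas // m ∈ ctx C} :=
  Equiv.ofBijective (fun k => ⟨ctxMeas C k, ctxMeas_mem_ctx C k⟩)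
    ⟨fun _ _ h => ctxMeas_injective C (congrArg Subtype.val h), fun m =>
      ((mem_ctx_iff C m).1 m.2).imp fun _ => Subtype.ext⟩

/-- The correlation `∑ₖ (-1)^(s k) e_{m_k}` on the context `C = {m₀, m₁, m₂}`. -/
def row (C : Ctx) (s : Fin 3 → ZMod 2) : Corr →L[ℝ] ℝ :=
  ∑ k, sgn (s k) • ContinuousLinearMap.proj (ctxMeas C k)

theorem row_apply (C : Ctx) (s : Fin 3 → ZMod 2) (e : Corr) :
    row C s e = ∑ k, sgn (s k) * e (ctxMeas C k) := by
  simp [row]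

theorem row_eq_sum_ctx (C : Ctx) (s : Assign (ctx C)) (e : Corr) :
    row C (s ∘ ctxEquiv C) e = ∑ m, sgn (s m) * e m.1 := by
  rw [row_apply, ← (ctxEquiv C).sum_comp]
  rfl

/-- The pairs of a context `C` and outcomes `s` on it whose parity is `β C`. -/
abbrev Facet (β : Ctx → ZMod 2) : Type :=
  {f : Ctx × (Fin 3 → ZMod 2) // ∑ k, f.2 k = β f.1}

/-- The polytope of the vectors of expectation values of the points of `MP_β`. -/
def corrPolytope (β : Ctx → ZMod 2) : Set Corr :=
  polyhedron (fun f : Facet β => row f.1.1 f.1.2) (fun _ => -1)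

theorem neg_one_le_row {β : Ctx → ZMod 2} {e : Corr} (he : e ∈ corrPolytope β) {C : Ctx}
    {s : Fin 3 → ZMod 2} (hs : ∑ k, s k = β C) : -1 ≤ row C s e :=
  he ⟨(C, s), hs⟩

/-- The distribution with given expectation values. -/
def distOf (β : Ctx → ZMod 2) (e : Corr) : Dist := fun C s =>
  if ∑ m, s m = β C then (1 + ∑ m, sgn (s m) * e m.1) / 4 else 0

theorem prob_distOf (β : Ctx → ZMod 2) (e : Corr) (C : Ctx) (m : {m : Meas // m ∈ ctx C})
    (a : ZMod 2) : prob (distOf β e) C m a = (1 + sgn a * e m.1) / 2 := by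
  have h1 : prob (distOf β e) C m a =
      ∑ s : Assign (ctx C) with s m = a ∧ ∑ m, s m = β C, (1 + ∑ m', sgn (s m') * e m'.1) / 4 := by
    rw [prob, ← Finset.filter_filter]
    exact (Finset.sum_filter _ _).symm
  have h2 : ∀ m' : {m : Meas // m ∈ ctx C},
      ∑ s : Assign (ctx C) with s m = a ∧ ∑ m, s m = β C, sgn (s m') =
        if m' = m then 2 * sgn a else 0 := by
    intro m'
    have := congrArg (Int.cast : ℤ → ℝ) (sum_filter_parity C (β C) m m' a)
    push_cast [cast_sgnZ] at this
    exact this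
  rw [h1, ← Finset.sum_div, Finset.sum_add_distrib, Finset.sum_comm]
  simp_rw [← Finset.sum_mul, h2]
  rw [Finset.sum_const, card_filter_parity]
  simp
  ring

theorem sum_eq_prob_add_prob (p : Dist) (C : Ctx) (m : {m : Meas // m ∈ ctx C}) :
    ∑ s, p C s = prob p C m 0 + prob p C m 1 := by
  rw [prob, prob, ← Finset.sum_filter_add_sum_filter_not Finset.univ (fun s => s m = 0)]
  congr 2
  ext s
  have := zmod2_eq_zero_or_one (s m)
  aesop

theorem sum_sgn_eq_prob_sub_prob (p : Dist) (C : Ctx) (m : {m : Meas // m ∈ ctx C}) :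
    ∑ s, sgn (s m) * p C s = prob p C m 0 - prob p C m 1 := by
  rw [prob, prob, ← Finset.sum_filter_add_sum_filter_not Finset.univ (fun s => s m = 0),
    sub_eq_add_neg, ← Finset.sum_neg_distrib]
  congr 1
  · refine Finset.sum_congr rfl fun s hs => ?_
    rw [(Finset.mem_filter.1 hs).2, sgn_zero, one_mul]
  · refine Finset.sum_congr ?_ fun s hs => ?_
    · ext s
      have := zmod2_eq_zero_or_one (s m)
      aesop
    · rw [(Finset.mem_filter.1 hs).2, sgn_one, neg_one_mul]

theorem ctx_inter_cases : ∀ C C' : Ctx,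
    C = C' ∨ ctx C ∩ ctx C' = ∅ ∨ ∃ m, ctx C ∩ ctx C' = {m} := by
  decide +kernel

theorem marginal_singleton {U V : Finset Meas} (h : V ⊆ U) (f : Assign U → ℝ) {m : Meas}
    (hV : V = {m}) (hm : m ∈ V) (t : Assign V) :
    marginal h f t = ∑ s with s ⟨m, h hm⟩ = t ⟨m, hm⟩, f s := by
  subst hV
  refine Finset.sum_congr ?_ fun _ _ => rfl
  ext s
  simp only [Finset.mem_filter, Finset.mem_univ, true_and]
  constructor
  · rintro rfl; rfl
  · intro hs
    ext ⟨x, hx⟩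
    obtain rfl := Finset.mem_singleton.1 hx
    rw [← hs]; rfl

theorem marginal_empty {U V : Finset Meas} (h : V ⊆ U) (f : Assign U → ℝ) (hV : V = ∅)
    (t : Assign V) : marginal h f t = ∑ s, f s := by
  subst hV
  refine Finset.sum_congr ?_ fun _ _ => rfl
  ext s
  simp only [Finset.mem_filter, Finset.mem_univ, true_and, iff_true]
  ext ⟨x, hx⟩
  simp at hx

theorem prob_eq_of_mem_NS {p : Dist} (hp : p ∈ NS) {C C' : Ctx} {m : Meas} (hC : m ∈ ctx C)
    (hC' : m ∈ ctx C') (a : ZMod 2) : prob p C ⟨m, hC⟩ a = prob p C' ⟨m, hC'⟩ a := by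
  have hmem : m ∈ ctx C ∩ ctx C' := Finset.mem_inter.2 ⟨hC, hC'⟩
  rcases ctx_inter_cases C C' with rfl | h | ⟨m', h⟩
  · rfl
  · simp [h] at hmem
  · obtain rfl : m = m' := by simpa [h] using hmem
    have := congrFun (hp.2.2 C C') (fun _ => a)
    rwa [marginal_singleton _ _ h hmem, marginal_singleton _ _ h hmem] at this

theorem distOf_mem_MP {β : Ctx → ZMod 2} {e : Corr} (he : e ∈ corrPolytope β) :
    distOf β e ∈ MP β := by
  have hsum : ∀ C, ∑ s, distOf β e C s = 1 := by
    intro C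
    rw [sum_eq_prob_add_prob _ C (ctxEquiv C 0), prob_distOf, prob_distOf, sgn_zero, sgn_one]
    ring
  refine ⟨⟨fun C s => ?_, hsum, fun C C' => ?_⟩, fun C s hs => ?_⟩
  · rw [distOf]
    split_ifs with h
    · have := neg_one_le_row he (s := s ∘ ctxEquiv C) (((ctxEquiv C).sum_comp s).trans h)
      rw [row_eq_sum_ctx] at this
      linarith
    · rfl
  · rcases ctx_inter_cases C C' with rfl | h | ⟨m, h⟩
    · rfl
    · ext t
      rw [marginal_empty _ _ h, marginal_empty _ _ h, hsum, hsum]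
    · ext t
      have hmem : m ∈ ctx C ∩ ctx C' := by rw [h]; exact Finset.mem_singleton_self m
      rw [marginal_singleton _ _ h hmem, marginal_singleton _ _ h hmem]
      exact (prob_distOf β e C ⟨m, _⟩ _).trans (prob_distOf β e C' ⟨m, _⟩ _).symm
  · by_contra hne
    rw [distOf, if_neg hne] at hs
    exact lt_irrefl _ hs

theorem expect_distOf (β : Ctx → ZMod 2) (e : Corr) : expect (distOf β e) = e := by
  ext m
  rw [expect, prob_distOf, prob_distOf, sgn_zero, sgn_one]
  ring

theorem distOf_expect {β : Ctx → ZMod 2} {p : Dist} (hp : p ∈ MP β) :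
    distOf β (expect p) = p := by
  have hzero : ∀ C s, ∑ m, s m ≠ β C → p C s = 0 := fun C s h =>
    le_antisymm (not_lt.1 fun h' => h (hp.2 C s h')) (hp.1.1 C s)
  ext C t
  rw [distOf]
  split_ifs with ht
  · have hexp : ∀ m : {m : Meas // m ∈ ctx C}, expect p m.1 = ∑ s, sgn (s m) * p C s := by
      intro m
      rw [sum_sgn_eq_prob_sub_prob, expect]
      exact congrArg₂ _ (prob_eq_of_mem_NS hp.1 _ m.2 0) (prob_eq_of_mem_NS hp.1 _ m.2 1)
    have hcomm : ∑ m, sgn (t m) * expect p m.1 =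
        ∑ s, (∑ m, sgn (s m) * sgn (t m)) * p C s := by
      simp_rw [hexp, Finset.mul_sum, Finset.sum_mul]
      rw [Finset.sum_comm]
      exact Finset.sum_congr rfl fun s _ => Finset.sum_congr rfl fun m _ => by ring
    have hval : ∀ s, (∑ m, sgn (s m) * sgn (t m)) * p C s =
        (if s = t then 4 * p C t else 0) - p C s := by
      intro s
      by_cases hs : ∑ m, s m = β C
      · have := congrArg (Int.cast : ℤ → ℝ) (sum_sgnZ_mul_sgnZ C s t (hs.trans ht.symm))
        push_cast [cast_sgnZ] at this
        rw [this]
        split_ifs with h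
        · rw [h]; ring
        · ring
      · have hne : s ≠ t := fun h => hs (h ▸ ht)
        rw [hzero C s hs, if_neg hne]; ring
    rw [hcomm, Finset.sum_congr rfl fun s _ => hval s, Finset.sum_sub_distrib, hp.1.2.1 C]
    simp
  · exact (hzero C t ht).symm

theorem expect_mem_corrPolytope {β : Ctx → ZMod 2} {p : Dist} (hp : p ∈ MP β) :
    expect p ∈ corrPolytope β := by
  rintro ⟨⟨C, s⟩, hs⟩
  obtain ⟨t, rfl⟩ : ∃ t : Assign (ctx C), s = t ∘ ctxEquiv C :=
    ⟨s ∘ (ctxEquiv C).symm, by ext; simp⟩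
  have ht : ∑ m, t m = β C := ((ctxEquiv C).sum_comp t).symm.trans hs
  have hpos := hp.1.1 C t
  rw [← distOf_expect hp, distOf, if_pos ht] at hpos
  rw [row_eq_sum_ctx]
  linarith

theorem MP_eq_image (β : Ctx → ZMod 2) : MP β = distOf β '' corrPolytope β :=
  Set.Subset.antisymm (fun p hp => ⟨expect p, expect_mem_corrPolytope hp, distOf_expect hp⟩)
    (Set.image_subset_iff.2 fun _ he => distOf_mem_MP he)

theorem distOf_injective (β : Ctx → ZMod 2) : Function.Injective (distOf β) :=
  Function.LeftInverse.injective (expect_distOf β)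

/-- The linear part of `distOf β`. -/
def distOfLin (β : Ctx → ZMod 2) : Corr →ₗ[ℝ] Dist where
  toFun e := fun C s => if ∑ m, s m = β C then (∑ m, sgn (s m) * e m.1) / 4 else 0
  map_add' x y := by
    ext C s
    simp only [Pi.add_apply]
    split_ifs
    · rw [← add_div, ← Finset.sum_add_distrib]; simp only [mul_add]
    · simp
  map_smul' a x := by
    ext C s
    simp only [Pi.smul_apply, smul_eq_mul, RingHom.id_apply]
    split_ifs
    · rw [← mul_div_assoc, Finset.mul_sum]; simp only [mul_left_comm]
    · simp

theorem distOf_add (β : Ctx → ZMod 2) (x d : Corr) :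
    distOf β (x + d) = distOf β x + distOfLin β d := by
  ext C s
  simp only [distOf, distOfLin, LinearMap.coe_mk, AddHom.coe_mk, Pi.add_apply]
  split_ifs
  · simp only [mul_add, Finset.sum_add_distrib]; ring
  · simp

/-- `distOf β` as an affine map. -/
def distOfAff (β : Ctx → ZMod 2) : Corr →ᵃ[ℝ] Dist where
  toFun := distOf β
  linear := distOfLin β
  map_vadd' x d := by simp only [vadd_eq_add]; rw [add_comm d x, distOf_add, add_comm]

/-- `expect` as a continuous linear map. -/
def expectCLM : Dist →L[ℝ] Corr :=
  LinearMap.toContinuousLinearMap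
    { toFun := expect
      map_add' := fun p q => by
        ext m
        simp only [expect, prob, Pi.add_apply, Finset.sum_add_distrib]; ring
      map_smul' := fun a p => by
        ext m
        simp only [expect, prob, Pi.smul_apply, smul_eq_mul, ← Finset.mul_sum,
          RingHom.id_apply]; ring }

/-! ### Deterministic measurements -/

section Deterministic

variable {β : Ctx → ZMod 2} {e v w x : Corr}

theorem row_eq_add (C : Ctx) (s : Fin 3 → ZMod 2) (e : Corr) {a b c : Fin 3} (hab : a ≠ b)
    (hac : a ≠ c) (hbc : b ≠ c) :
    row C s e = sgn (s a) * e (ctxMeas C a) + sgn (s b) * e (ctxMeas C b) +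
      sgn (s c) * e (ctxMeas C c) := by
  have huniv : (Finset.univ : Finset (Fin 3)) = {a, b, c} := by
    revert a b c; decide
  rw [row_apply, huniv, Finset.sum_insert (by simp [hab, hac]), Finset.sum_pair hbc, add_assoc]

theorem exists_eq_and_forall_ne_eq_add_one : ∀ s t : Fin 3 → ZMod 2, ∑ k, s k = ∑ k, t k →
    s ≠ t → ∃ a, t a = s a ∧ ∀ b, b ≠ a → t b = s b + 1 := by
  decide

theorem sgn_add_one (a : ZMod 2) : sgn (a + 1) = -sgn a := by
  rw [sgn_add, sgn_one, mul_neg_one]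

theorem exists_row_add_row (C : Ctx) {s t : Fin 3 → ZMod 2} (h : ∑ k, s k = ∑ k, t k)
    (hst : s ≠ t) : ∃ a, ∀ e, row C s e + row C t e = 2 * sgn (s a) * e (ctxMeas C a) := by
  obtain ⟨a, ha, hne⟩ := exists_eq_and_forall_ne_eq_add_one s t h hst
  refine ⟨a, fun e => ?_⟩
  rw [row_apply, row_apply, ← Finset.sum_add_distrib, Finset.sum_eq_single a]
  · rw [ha]; ring
  · intro b _ hb
    rw [hne b hb, sgn_add_one]; ring
  · simp

theorem exists_outcomes (b : ZMod 2) {k₀ k₁ : Fin 3} (h : k₀ ≠ k₁) (x y : ZMod 2) :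
    ∃ s : Fin 3 → ZMod 2, ∑ k, s k = b ∧ s k₀ = x ∧ s k₁ = y := by
  revert b k₀ k₁ x y; decide

theorem eq_add_add_of_sum_eq {s : Fin 3 → ZMod 2} {b : ZMod 2} (h : ∑ k, s k = b) {k₀ k₁ k₂ : Fin 3}
    (h₀₁ : k₀ ≠ k₁) (h₀₂ : k₀ ≠ k₂) (h₁₂ : k₁ ≠ k₂) : s k₂ = b + s k₀ + s k₁ := by
  revert s b k₀ k₁ k₂; decide

theorem exists_row_eq (C : Ctx) (x₀ y z : ZMod 2) {a b c : Fin 3} (hab : a ≠ b) (hac : a ≠ c)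
    (hbc : b ≠ c) : ∃ s : Fin 3 → ZMod 2, ∑ k, s k = x₀ ∧ s a = y ∧ ∀ e, row C s e =
      sgn y * e (ctxMeas C a) +
        sgn z * (e (ctxMeas C b) + sgn (x₀ + y) * e (ctxMeas C c)) := by
  obtain ⟨s, hs, hsa, hsb⟩ := exists_outcomes x₀ hab y z
  refine ⟨s, hs, hsa, fun e => ?_⟩
  rw [row_eq_add C s e hab hac hbc, eq_add_add_of_sum_eq hs hab hac hbc, hsa, hsb, sgn_add _ z]
  ring

theorem exists_ne_ne_ne : ∀ a : Fin 3, ∃ b c, a ≠ b ∧ a ≠ c ∧ b ≠ c := by decide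

theorem abs_apply_le_one (he : e ∈ corrPolytope β) (m : Meas) : |e m| ≤ 1 := by
  obtain ⟨C, a, rfl⟩ : ∃ C a, ctxMeas C a = m := ⟨Sum.inl m.1, m.2, rfl⟩
  obtain ⟨b, c, hab, hac, hbc⟩ := exists_ne_ne_ne a
  have key (y : ZMod 2) : -1 ≤ sgn y * e (ctxMeas C a) := by
    obtain ⟨s, hs, -, hrow⟩ := exists_row_eq C (β C) y 0 hab hac hbc
    obtain ⟨t, ht, -, hrow'⟩ := exists_row_eq C (β C) y 1 hab hac hbc
    have h := neg_one_le_row he hs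
    have h' := neg_one_le_row he ht
    rw [hrow, sgn_zero] at h
    rw [hrow', sgn_one] at h'
    linarith
  have h₀ := key 0
  have h₁ := key 1
  rw [sgn_zero] at h₀
  rw [sgn_one] at h₁
  exact abs_le.2 ⟨by linarith, by linarith⟩

theorem isCompact_corrPolytope : IsCompact (corrPolytope β) :=
  (isCompact_Icc (a := (-1 : Corr)) (b := 1)).of_isClosed_subset isClosed_polyhedron
    fun _ he => ⟨fun m => (abs_le.1 (abs_apply_le_one he m)).1,
      fun m => (abs_le.1 (abs_apply_le_one he m)).2⟩

theorem apply_eq_sgn_mul_apply (he : e ∈ corrPolytope β) {C : Ctx} {a b c : Fin 3} (hab : a ≠ b)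
    (hac : a ≠ c) (hbc : b ≠ c) {x : ZMod 2} (hx : e (ctxMeas C a) = sgn x) :
    e (ctxMeas C b) = sgn (β C + x) * e (ctxMeas C c) := by
  have key (z : ZMod 2) : 0 ≤ sgn z * (e (ctxMeas C b) - sgn (β C + x) * e (ctxMeas C c)) := by
    obtain ⟨s, hs, -, hrow⟩ := exists_row_eq C (β C) (x + 1) z hab hac hbc
    have h := neg_one_le_row he hs
    rw [hrow, hx, ← add_assoc, sgn_add_one, sgn_add_one] at h
    linarith [sgn_mul_self x]
  have h₀ := key 0
  have h₁ := key 1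
  rw [sgn_zero] at h₀
  rw [sgn_one] at h₁
  linarith

theorem abs_sgn (a : ZMod 2) : |sgn a| = 1 := by
  rcases sgn_eq_or a with ⟨-, h⟩ | ⟨-, h⟩ <;> simp [h]

/-- The measurements with a deterministic outcome. -/
def detSet (e : Corr) : Finset Meas := {m | |e m| = 1}

theorem mem_detSet {m : Meas} : m ∈ detSet e ↔ ∃ a, e m = sgn a := by
  simp only [detSet, Finset.mem_filter, Finset.mem_univ, true_and]
  exact ⟨exists_sgn_eq, fun ⟨a, h⟩ => h ▸ abs_sgn a⟩

theorem isClosedSet_detSet (he : e ∈ corrPolytope β) : IsClosedSet (detSet e) := by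
  intro C m hm m' hm' hne hdet hdet' n hn
  simp only [mem_ctx_iff] at hm hm' hn
  obtain ⟨⟨a, rfl⟩, ⟨b, rfl⟩, ⟨c, rfl⟩⟩ := And.intro hm (And.intro hm' hn)
  obtain ⟨⟨x, hx⟩, ⟨y, hy⟩⟩ := And.intro (mem_detSet.1 hdet) (mem_detSet.1 hdet')
  rcases eq_or_ne a c with rfl | hac
  · exact hdet
  rcases eq_or_ne b c with rfl | hbc
  · exact hdet'
  exact mem_detSet.2 ⟨β C + x + y, by
    rw [apply_eq_sgn_mul_apply he hac (ne_of_apply_ne _ hne) hbc.symm hx, hy, sgn_add (β C + x)]⟩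

theorem sum_eq_of_apply_eq_sgn (he : e ∈ corrPolytope β) {C : Ctx} {s : Fin 3 → ZMod 2}
    (hs : ∀ k, e (ctxMeas C k) = sgn (s k)) : ∑ k, s k = β C := by
  have h := apply_eq_sgn_mul_apply he (a := 0) (b := 1) (c := 2) (by decide) (by decide)
    (by decide) (hs 0)
  rw [hs, hs, ← sgn_add] at h
  rw [Fin.sum_univ_three, sgn_injective h]
  generalize s 0 = x, s 2 = z, β C = b
  revert x z b; decide

theorem row_eq_neg_one (he : e ∈ corrPolytope β) {C : Ctx} {a : Fin 3} {x : ZMod 2}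
    (hx : e (ctxMeas C a) = sgn x) {s : Fin 3 → ZMod 2} (hs : ∑ k, s k = β C)
    (hsa : s a = x + 1) : row C s e = -1 := by
  obtain ⟨b, c, hab, hac, hbc⟩ := exists_ne_ne_ne a
  rw [row_eq_add C s e hab hac hbc, hx, apply_eq_sgn_mul_apply he hab hac hbc hx,
    eq_add_add_of_sum_eq hs hab hac hbc, hsa, ← add_assoc]
  simp only [sgn_add, sgn_one]
  linear_combination (-1) * sgn_mul_self x

/-- `x` lies on all facets of the polytope that contain both `v` and `w`, that is, on the smallest
face with this property. -/
def OnCommonFacets (β : Ctx → ZMod 2) (v w x : Corr) : Prop :=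
  ∀ ⦃C s⦄, ∑ k, s k = β C → row C s v = -1 → row C s w = -1 → row C s x = -1

theorem OnCommonFacets.apply_eq_sgn (h : OnCommonFacets β v w x) (hv : v ∈ corrPolytope β)
    (hw : w ∈ corrPolytope β) {m : Meas} {y : ZMod 2} (hvm : v m = sgn y) (hwm : w m = sgn y) :
    x m = sgn y := by
  obtain ⟨C, a, rfl⟩ : ∃ C a, ctxMeas C a = m := ⟨Sum.inl m.1, m.2, rfl⟩
  obtain ⟨b, c, hab, hac, hbc⟩ := exists_ne_ne_ne a
  have key (z : ZMod 2) : -sgn y * x (ctxMeas C a) +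
      sgn z * (x (ctxMeas C b) + sgn (β C + (y + 1)) * x (ctxMeas C c)) = -1 := by
    obtain ⟨s, hs, hsa, hrow⟩ := exists_row_eq C (β C) (y + 1) z hab hac hbc
    rw [← sgn_add_one, ← hrow]
    exact h hs (row_eq_neg_one hv hvm hs hsa) (row_eq_neg_one hw hwm hs hsa)
  have h₀ := key 0
  have h₁ := key 1
  rw [sgn_zero] at h₀
  rw [sgn_one] at h₁
  have : sgn y * x (ctxMeas C a) = 1 := by linarith
  linear_combination sgn y * this - x (ctxMeas C a) * sgn_mul_self y

theorem isExposed_segment_of_onCommonFacets (hv : v ∈ corrPolytope β) (hw : w ∈ corrPolytope β)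
    (h : ∀ x ∈ corrPolytope β, OnCommonFacets β v w x → x ∈ segment ℝ v w) :
    IsExposed ℝ (corrPolytope β) (segment ℝ v w) :=
  isExposed_segment_of_tight hv hw fun x hx hvw => h x hx fun C s hs => hvw ⟨(C, s), hs⟩

theorem mem_extremePoints_of_onCommonFacets (hv : v ∈ corrPolytope β)
    (h : ∀ x ∈ corrPolytope β, OnCommonFacets β v v x → x = v) :
    v ∈ (corrPolytope β).extremePoints ℝ :=
  mem_extremePoints_of_tight hv fun x hx hvx => h x hx fun C s hs hv _ => hvx ⟨(C, s), hs⟩ hv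

end Deterministic

section RankCount

variable {β : Ctx → ZMod 2} {v : Corr}

theorem row_eq_zero_of_subset_detSet {C : Ctx} (hC : ctx C ⊆ detSet v) (s : Fin 3 → ZMod 2)
    {d : Corr} (hd : ∀ m ∈ detSet v, d m = 0) : row C s d = 0 := by
  rw [row_apply]
  exact Finset.sum_eq_zero fun k _ => by rw [hd _ (hC (ctxMeas_mem_ctx C k)), mul_zero]

/-- Modulo the deterministic measurements, a context has at most one tight inequality. -/
theorem exists_row_forall_tight_row_eq_zero (β : Ctx → ZMod 2) (v : Corr) (C : Ctx) :
    ∃ r : Fin 3 → ZMod 2, ∀ d : Corr, (∀ m ∈ detSet v, d m = 0) → row C r d = 0 →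
      ∀ s, ∑ k, s k = β C → row C s v = -1 → row C s d = 0 := by
  by_cases htight : ∃ r, ∑ k, r k = β C ∧ row C r v = -1
  · obtain ⟨r, hr, hrv⟩ := htight
    refine ⟨r, fun d hd hrd s hs hsv => ?_⟩
    rcases eq_or_ne s r with rfl | hne
    · exact hrd
    obtain ⟨a, ha⟩ := exists_row_add_row C (hs.trans hr.symm) hne
    have hdet : ctxMeas C a ∈ detSet v := by
      refine mem_detSet.2 ⟨s a + 1, ?_⟩
      rw [sgn_add_one]
      have := ha v
      rw [hsv, hrv] at this
      linear_combination (-sgn (s a) / 2) * this - v (ctxMeas C a) * sgn_mul_self (s a)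
    have := ha d
    rw [hd _ hdet] at this
    linarith
  · push Not at htight
    exact ⟨0, fun d _ _ s hs hsv => absurd hsv (htight s hs)⟩

/-- The measurements in `detSet v` together with one correlation for each context outside of it
separate points, so there are at least nine of them. -/
theorem nine_le_card_of_mem_extremePoints (hv : v ∈ (corrPolytope β).extremePoints ℝ) :
    9 ≤ (detSet v).card + (Finset.univ.filter fun C => ¬ ctx C ⊆ detSet v).card := by
  choose r hr using exists_row_forall_tight_row_eq_zero β v
  let D := {m // m ∈ detSet v}
  let K := {C // ¬ ctx C ⊆ detSet v}
  let f : Corr →ₗ[ℝ] (D ⊕ K → ℝ) :=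
    LinearMap.pi (Sum.elim (fun m => LinearMap.proj m.1) (fun C => (row C.1 (r C.1)).toLinearMap))
  have hf : Function.Injective f := by
    rw [← LinearMap.ker_eq_bot, LinearMap.ker_eq_bot']
    intro d hd
    have hdet (m) (hm : m ∈ detSet v) : d m = 0 := congrFun hd (Sum.inl ⟨m, hm⟩)
    refine eq_zero_of_mem_extremePoints hv fun ⟨⟨C, s⟩, hs⟩ hsv => ?_
    by_cases hC : ctx C ⊆ detSet v
    · exact row_eq_zero_of_subset_detSet hC s hdet
    · exact hr C d hdet (congrFun hd (Sum.inr ⟨C, hC⟩)) s hs hsv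
  have hrank := LinearMap.finrank_le_finrank_of_injective hf
  simpa [D, K, Fintype.card_subtype] using hrank

/-- The graph of a permutation: three measurements, one in each context. -/
def transversal (σ : Equiv.Perm (Fin 3)) : Finset Meas := {m | σ m.1 = m.2}

/-- The union of the contexts `C_i^hor` and `C_j^ver`. -/
def cross (i j : Fin 3) : Finset Meas := {m | m.1 = i ∨ m.2 = j}

set_option synthInstance.maxSize 400 in
instance : DecidablePred IsClosedSet := fun Ω => by unfold IsClosedSet; infer_instance

theorem eq_transversal_or_eq_cross_or_eq_univ : ∀ Ω : Finset Meas, IsClosedSet Ω →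
    9 ≤ Ω.card + (Finset.univ.filter fun C => ¬ ctx C ⊆ Ω).card →
    (∃ σ, Ω = transversal σ) ∨ (∃ i j, Ω = cross i j) ∨ Ω = Finset.univ := by
  decide +kernel

theorem detSet_cases (hv : v ∈ (corrPolytope β).extremePoints ℝ) :
    (∃ σ, detSet v = transversal σ) ∨ (∃ i j, detSet v = cross i j) ∨
      detSet v = Finset.univ :=
  eq_transversal_or_eq_cross_or_eq_univ _ (isClosedSet_detSet hv.1)
    (nine_le_card_of_mem_extremePoints hv)

end RankCount

/-! ### The even polytope -/

section Even

variable {v x : Corr} {t u : Meas → ZMod 2}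

/-- Functions with an even number of ones in each context. -/
def IsEven (t : Meas → ZMod 2) : Prop := ∀ C, ∑ k, t (ctxMeas C k) = 0

instance : DecidablePred IsEven := fun t => by unfold IsEven; infer_instance

theorem IsEven.add (ht : IsEven t) (hu : IsEven u) : IsEven (t + u) := fun C => by
  simp only [Pi.add_apply, Finset.sum_add_distrib, ht C, hu C, add_zero]

theorem card_isEven : Fintype.card {t // IsEven t} = 16 := by decide +kernel

theorem exists_isEven_eq_zero_iff_transversal : ∀ σ : Equiv.Perm (Fin 3),
    ∃ u, IsEven u ∧ ∀ m, u m = 0 ↔ m ∈ transversal σ := by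
  decide +kernel

theorem exists_isEven_eq_zero_iff_cross : ∀ i j,
    ∃ u, IsEven u ∧ ∀ m, u m = 0 ↔ m ∈ cross i j := by
  decide +kernel

theorem exists_isEven_transversal : ∀ (σ : Equiv.Perm (Fin 3)) (s : Fin 3 → ZMod 2),
    ∃ t, IsEven t ∧ ∀ i, t (i, σ i) = s i := by
  decide +kernel

theorem exists_isEven_cross : ∀ (i j : Fin 3) (r c : Fin 3 → ZMod 2), ∑ k, r k = 0 →
    ∑ k, c k = 0 → r j = c i → ∃ t, IsEven t ∧ (∀ k, t (i, k) = r k) ∧ ∀ k, t (k, j) = c k := by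
  decide +kernel

/-- The measurements `m` with `u m = 1` form a loop, so any two of them are connected through
shared contexts. -/
theorem exists_path : ∀ u, IsEven u → ∀ m m', u m = 1 → u m' = 1 →
    ∃ m₁ m₂, u m₁ = 1 ∧ u m₂ = 1 ∧
      (m.1 = m₁.1 ∨ m.2 = m₁.2) ∧ (m₁.1 = m₂.1 ∨ m₁.2 = m₂.2) ∧ (m₂.1 = m'.1 ∨ m₂.2 = m'.2) := by
  decide +kernel

/-- The vector of expectation values of the deterministic outcomes `t`. -/
def detPoint (t : Meas → ZMod 2) : Corr := fun m => sgn (t m)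

theorem detPoint_injective : Function.Injective detPoint := fun _ _ h =>
  funext fun m => sgn_injective (congrFun h m)

theorem neg_one_le_sum_sgnZ : ∀ s : Fin 3 → ZMod 2, ∑ k, s k = 0 → -1 ≤ ∑ k, sgnZ (s k) := by
  decide

theorem detPoint_mem_corrPolytope (ht : IsEven t) : detPoint t ∈ corrPolytope beta0 := by
  rintro ⟨⟨C, s⟩, hs : ∑ k, s k = 0⟩
  have h : -1 ≤ ∑ k, sgnZ (s k + t (ctxMeas C k)) :=
    neg_one_le_sum_sgnZ _ (by rw [Finset.sum_add_distrib, hs, ht C, add_zero])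
  rw [row_apply]
  have h' : (-1 : ℝ) ≤ ∑ k, sgn (s k + t (ctxMeas C k)) := by
    simp only [← cast_sgnZ]; exact_mod_cast h
  simpa only [detPoint, ← sgn_add] using h'

theorem detPoint_mem_extremePoints (ht : IsEven t) :
    detPoint t ∈ (corrPolytope beta0).extremePoints ℝ :=
  have hmem := detPoint_mem_corrPolytope ht
  mem_extremePoints_of_onCommonFacets hmem fun _ _ h =>
    funext fun _ => h.apply_eq_sgn hmem hmem rfl rfl

theorem exists_ne_and_ne : ∀ b c : Fin 3, ∃ a, b ≠ a ∧ c ≠ a := by decide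

theorem sgn_mul_apply_eq_sgn_mul_apply (hx : x ∈ corrPolytope beta0) (ht : IsEven t)
    (hu : IsEven u) (h : ∀ m, u m = 0 → x m = sgn (t m)) {C : Ctx} {b c : Fin 3}
    (hb : u (ctxMeas C b) = 1) (hc : u (ctxMeas C c) = 1) :
    sgn (t (ctxMeas C b)) * x (ctxMeas C b) = sgn (t (ctxMeas C c)) * x (ctxMeas C c) := by
  rcases eq_or_ne b c with rfl | hbc
  · rfl
  obtain ⟨a, hba, hca⟩ := exists_ne_and_ne b c
  have hua : u (ctxMeas C a) = 0 := by
    rw [eq_add_add_of_sum_eq (hu C) hbc hba hca, hb, hc]; decide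
  rw [apply_eq_sgn_mul_apply hx hba.symm hca.symm hbc (h _ hua), ← mul_assoc, ← sgn_add,
    eq_add_add_of_sum_eq (ht C) hba hbc hca.symm]
  congr 2
  simp only [beta0]
  generalize t (ctxMeas C a) = y, t (ctxMeas C b) = z
  revert y z; decide

theorem sgn_mul_apply_eq_of_support (hx : x ∈ corrPolytope beta0) (ht : IsEven t)
    (hu : IsEven u) (h : ∀ m, u m = 0 → x m = sgn (t m)) {m m' : Meas}
    (hm : u m = 1) (hm' : u m' = 1) : sgn (t m) * x m = sgn (t m') * x m' := by
  have hshare : ∀ {n n' : Meas}, u n = 1 → u n' = 1 → n.1 = n'.1 ∨ n.2 = n'.2 →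
      sgn (t n) * x n = sgn (t n') * x n' := by
    rintro ⟨i, j⟩ ⟨i', j'⟩ hn hn' (rfl | rfl : i = i' ∨ j = j')
    · exact sgn_mul_apply_eq_sgn_mul_apply hx ht hu h (C := Sum.inl i) hn hn'
    · exact sgn_mul_apply_eq_sgn_mul_apply hx ht hu h (C := Sum.inr j) hn hn'
  obtain ⟨m₁, m₂, h₁, h₂, hm₁, hm₁₂, hm₂⟩ := exists_path u hu m m' hm hm'
  exact (hshare hm h₁ hm₁).trans ((hshare h₁ h₂ hm₁₂).trans (hshare h₂ hm' hm₂))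

theorem mem_segment_detPoint_add (hx : x ∈ corrPolytope beta0) (ht : IsEven t) (hu : IsEven u)
    (h : ∀ m, u m = 0 → x m = sgn (t m)) : x ∈ segment ℝ (detPoint t) (detPoint (t + u)) := by
  obtain ⟨c, hc, hcu⟩ : ∃ c : ℝ, |c| ≤ 1 ∧ ∀ m, u m = 1 → sgn (t m) * x m = c := by
    by_cases hne : ∃ m, u m = 1
    · obtain ⟨m, hm⟩ := hne
      refine ⟨sgn (t m) * x m, ?_, fun m' hm' => sgn_mul_apply_eq_of_support hx ht hu h hm' hm⟩
      rw [abs_mul, abs_sgn, one_mul]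
      exact abs_apply_le_one hx m
    · exact ⟨0, by norm_num, fun m hm => absurd ⟨m, hm⟩ hne⟩
  rw [abs_le] at hc
  refine ⟨(1 + c) / 2, (1 - c) / 2, by linarith, by linarith, by ring, funext fun m => ?_⟩
  simp only [detPoint, Pi.add_apply, Pi.smul_apply, smul_eq_mul]
  rcases zmod2_eq_zero_or_one (u m) with hm | hm
  · rw [hm, add_zero, h m hm]; ring
  · rw [hm, sgn_add_one, ← hcu m hm]
    linear_combination x m * sgn_mul_self (t m)

theorem isExposed_segment_detPoint (ht : IsEven t) (hu : IsEven u) :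
    IsExposed ℝ (corrPolytope beta0) (segment ℝ (detPoint t) (detPoint u)) := by
  have ht' := detPoint_mem_corrPolytope ht
  have hu' := detPoint_mem_corrPolytope hu
  refine isExposed_segment_of_onCommonFacets ht' hu' fun x hx hxtu => ?_
  have hsum : t + (t + u) = u := by
    rw [← add_assoc, CharTwo.add_self_eq_zero, zero_add]
  rw [← hsum]
  refine mem_segment_detPoint_add hx ht (ht.add hu) fun m hm => ?_
  exact hxtu.apply_eq_sgn ht' hu' rfl (congrArg sgn (CharTwo.add_eq_zero.1 hm).symm)

theorem exists_isEven_extending {Ω : Finset Meas}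
    (hΩ : (∃ σ, Ω = transversal σ) ∨ ∃ i j, Ω = cross i j) {s : Meas → ZMod 2}
    (hs : ∀ C, ctx C ⊆ Ω → ∑ k, s (ctxMeas C k) = 0) :
    ∃ t, IsEven t ∧ ∀ m ∈ Ω, t m = s m := by
  rcases hΩ with ⟨σ, rfl⟩ | ⟨i, j, rfl⟩
  · obtain ⟨t, ht, hts⟩ := exists_isEven_transversal σ fun i => s (i, σ i)
    refine ⟨t, ht, fun ⟨i, j⟩ hm => ?_⟩
    obtain rfl : σ i = j := by simpa [transversal] using hm
    exact hts i
  · have hi : ctx (Sum.inl i) ⊆ cross i j := fun m hm => by simp_all [cross, ctx]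
    have hj : ctx (Sum.inr j) ⊆ cross i j := fun m hm => by simp_all [cross, ctx]
    obtain ⟨t, ht, htr, htc⟩ := exists_isEven_cross i j (fun k => s (i, k)) (fun k => s (k, j))
      (hs _ hi) (hs _ hj) rfl
    refine ⟨t, ht, fun ⟨k, l⟩ hm => ?_⟩
    rcases (by simpa [cross] using hm : k = i ∨ l = j) with rfl | rfl
    · exact htr l
    · exact htc k

theorem exists_isEven_eq_zero_iff {Ω : Finset Meas}
    (hΩ : (∃ σ, Ω = transversal σ) ∨ ∃ i j, Ω = cross i j) :
    ∃ u, IsEven u ∧ ∀ m, u m = 0 ↔ m ∈ Ω := by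
  rcases hΩ with ⟨σ, rfl⟩ | ⟨i, j, rfl⟩
  · exact exists_isEven_eq_zero_iff_transversal σ
  · exact exists_isEven_eq_zero_iff_cross i j

theorem exists_eq_detPoint_of_mem_extremePoints
    (hv : v ∈ (corrPolytope beta0).extremePoints ℝ) : ∃ t, IsEven t ∧ v = detPoint t := by
  obtain ⟨s, hs⟩ : ∃ s : Meas → ZMod 2, ∀ m ∈ detSet v, v m = sgn (s m) := by
    have (m : Meas) : ∃ a, m ∈ detSet v → v m = sgn a := by
      by_cases hm : m ∈ detSet v
      · exact (mem_detSet.1 hm).imp fun _ h _ => h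
      · exact ⟨0, fun h => absurd h hm⟩
    exact ⟨fun m => (this m).choose, fun m => (this m).choose_spec⟩
  have hsum (C) (hC : ctx C ⊆ detSet v) : ∑ k, s (ctxMeas C k) = 0 :=
    sum_eq_of_apply_eq_sgn hv.1 fun k => hs _ (hC (ctxMeas_mem_ctx C k))
  rcases or_assoc.2 (detSet_cases hv) with hΩ | huniv
  · obtain ⟨t, ht, hts⟩ := exists_isEven_extending hΩ hsum
    obtain ⟨u, hu, hu0⟩ := exists_isEven_eq_zero_iff hΩ
    have hseg : v ∈ segment ℝ (detPoint t) (detPoint (t + u)) :=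
      mem_segment_detPoint_add hv.1 ht hu fun m hm => by
        rw [hs m ((hu0 m).1 hm), hts m ((hu0 m).1 hm)]
    rcases (mem_extremePoints_iff_forall_segment.1 hv).2 _ (detPoint_mem_corrPolytope ht) _
      (detPoint_mem_corrPolytope (ht.add hu)) hseg with h | h
    · exact ⟨t, ht, h.symm⟩
    · exact ⟨t + u, ht.add hu, h.symm⟩
  · have hmem (m) : m ∈ detSet v := huniv ▸ Finset.mem_univ m
    exact ⟨s, fun C => hsum C fun m _ => hmem m, funext fun m => hs m (hmem m)⟩

end Even

section Transport

variable {β : Ctx → ZMod 2} {v w : Corr}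

theorem extremePoints_MP (β : Ctx → ZMod 2) :
    (MP β).extremePoints ℝ = distOf β '' (corrPolytope β).extremePoints ℝ := by
  rw [MP_eq_image]
  exact extremePoints_image (distOfAff β) (distOf_injective β)

theorem isExposed_MP_segment (h : IsExposed ℝ (corrPolytope β) (segment ℝ v w)) :
    IsExposed ℝ (MP β) (segment ℝ (distOf β v) (distOf β w)) := by
  have := isExposed_image_of_leftInverse (distOfAff β) expectCLM (expect_distOf β) h
  rwa [image_segment, ← show MP β = distOfAff β '' corrPolytope β from MP_eq_image β] at this

theorem isExtreme_corrPolytope_segment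
    (h : IsExposed ℝ (MP β) (segment ℝ (distOf β v) (distOf β w))) :
    IsExtreme ℝ (corrPolytope β) (segment ℝ v w) := by
  rw [← isExtreme_image_iff (distOfAff β) (distOf_injective β), image_segment]
  exact MP_eq_image β ▸ h.isExtreme

end Transport

theorem bijective_distOf_detPoint :
    Function.Bijective fun t : {t // IsEven t} => (⟨distOf beta0 (detPoint t.1),
      extremePoints_MP beta0 ▸ Set.mem_image_of_mem _ (detPoint_mem_extremePoints t.2)⟩ :
        (MP beta0).extremePoints ℝ) := by
  refine ⟨fun s t h => Subtype.ext (detPoint_injective (distOf_injective _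
    (congrArg Subtype.val h))), fun ⟨p, hp⟩ => ?_⟩
  obtain ⟨v, hv, rfl⟩ := extremePoints_MP beta0 ▸ hp
  obtain ⟨t, ht, rfl⟩ := exists_eq_detPoint_of_mem_extremePoints hv
  exact ⟨⟨t, ht⟩, rfl⟩

theorem polytopeGraph_MP_beta0 :
    Nonempty (polytopeGraph (MP beta0) ≃g (⊤ : SimpleGraph (Fin 16))) := by
  let e := (Equiv.ofBijective _ bijective_distOf_detPoint).symm.trans
    (Fintype.equivFinOfCardEq card_isEven)
  refine ⟨⟨e, fun {p q} => ?_⟩⟩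
  simp only [SimpleGraph.top_adj, ne_eq, EmbeddingLike.apply_eq_iff_eq]
  refine ⟨fun hpq => ⟨hpq, ?_⟩, fun h => h.1⟩
  obtain ⟨s, rfl⟩ := bijective_distOf_detPoint.2 p
  obtain ⟨t, rfl⟩ := bijective_distOf_detPoint.2 q
  exact isExposed_MP_segment (isExposed_segment_detPoint s.2 t.2)

/-! ### The vertices of the odd polytope -/

section Odd

variable {e x : Corr}

/-- An integral vector as a vector of expectation values. -/
def castV (u : Meas → ℤ) : Corr := fun m => (u m : ℝ)

theorem castV_injective : Function.Injective castV := fun _ _ h =>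
  funext fun m => Int.cast_injective (congrFun h m)

/-- The functional `row C s` on integral vectors. -/
def rowZ (C : Ctx) (s : Fin 3 → ZMod 2) (u : Meas → ℤ) : ℤ :=
  ∑ k, sgnZ (s k) * u (ctxMeas C k)

theorem row_castV (C : Ctx) (s : Fin 3 → ZMod 2) (u : Meas → ℤ) :
    row C s (castV u) = rowZ C s u := by
  simp [row_apply, rowZ, castV, cast_sgnZ]

theorem castV_mem_corrPolytope {β : Ctx → ZMod 2} {u : Meas → ℤ}
    (h : ∀ C s, ∑ k, s k = β C → -1 ≤ rowZ C s u) : castV u ∈ corrPolytope β := by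
  rintro ⟨⟨C, s⟩, hs⟩
  have := h C s hs
  simp only [row_castV]
  exact_mod_cast this

/-- The data of a vertex of type 1: a permutation, whose graph is the cnc set, and an outcome for
each row. -/
abbrev Label1 : Type := Equiv.Perm (Fin 3) × (Fin 3 → ZMod 2)

/-- The data `(i, j, c, x, y)` of a vertex of type 2: the cnc set is `cross i j`, and the outcomes
of `m_{ij}`, `m_{i,j+1}` and `m_{i+1,j}` are `c`, `x` and `y`. -/
abbrev Label2 : Type := Fin 3 × Fin 3 × ZMod 2 × ZMod 2 × ZMod 2

/-- The integral vectors of the vertices of type 1. -/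
def vtx1 : Label1 → Meas → ℤ
  | (σ, s), m => if σ m.1 = m.2 then sgnZ (s m.1) else 0

/-- The integral vectors of the vertices of type 2; the values that are not part of the data are
forced by the parities of the row `i` and the column `j`. -/
def vtx2 : Label2 → Meas → ℤ
  | (i, j, c, x, y), m =>
    if m.1 = i then
      if m.2 = j then sgnZ c else if m.2 = j + 1 then sgnZ x else sgnZ (c + x)
    else if m.2 = j then
      if m.1 = i + 1 then sgnZ y else sgnZ (1 + c + y)
    else 0

/-- The integral vectors of the vertices. -/
def vtx : Label1 ⊕ Label2 → Meas → ℤ := Sum.elim vtx1 vtx2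

theorem neg_one_le_rowZ_vtx : ∀ a C s, ∑ k, s k = beta1 C → -1 ≤ rowZ C s (vtx a) := by
  decide +kernel

theorem vtx_eq_zero_or_eq_sgnZ : ∀ a m, vtx a m = 0 ∨ ∃ y, vtx a m = sgnZ y := by
  decide +kernel

set_option synthInstance.maxSize 400 in
theorem vtx_injective : Function.Injective vtx := by
  have : ∀ a b, (∀ m, vtx a m = vtx b m) → a = b := by decide +kernel
  exact fun a b h => this a b (congrFun h)

theorem castV_vtx_mem_corrPolytope (a : Label1 ⊕ Label2) :
    castV (vtx a) ∈ corrPolytope beta1 :=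
  castV_mem_corrPolytope (neg_one_le_rowZ_vtx a)

theorem apply_inl_eq (hx : x ∈ corrPolytope beta1) {i j k l : Fin 3} (hjk : j ≠ k) (hjl : j ≠ l)
    (hkl : k ≠ l) {y : ZMod 2} (hy : x (i, j) = sgn y) : x (i, k) = sgn y * x (i, l) := by
  have h := apply_eq_sgn_mul_apply hx (C := Sum.inl i) hjk hjl hkl hy
  rwa [beta1, zero_add] at h

theorem apply_inr_eq (hx : x ∈ corrPolytope beta1) {i j k l : Fin 3} (hik : i ≠ k) (hil : i ≠ l)
    (hkl : k ≠ l) {y : ZMod 2} (hy : x (i, j) = sgn y) : x (k, j) = -(sgn y * x (l, j)) := by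
  have h := apply_eq_sgn_mul_apply hx (C := Sum.inr j) hik hil hkl hy
  rwa [beta1, add_comm, sgn_add_one, neg_mul] at h

/-- The six remaining measurements form a loop along which the value changes sign an odd number
of times. -/
theorem apply_eq_zero_of_transversal (hx : x ∈ corrPolytope beta1) {σ : Equiv.Perm (Fin 3)}
    {s : Fin 3 → ZMod 2} (hs : ∀ i, x (i, σ i) = sgn (s i)) {i j : Fin 3} (hij : i ≠ j) :
    x (i, σ j) = 0 := by
  obtain ⟨k, hik, hjk⟩ : ∃ k, i ≠ k ∧ j ≠ k := exists_ne_and_ne i j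
  have rotate {i j k : Fin 3} (hij : i ≠ j) (hik : i ≠ k) (hjk : j ≠ k) :
      x (i, σ j) = -(sgn (s i) * sgn (s k) * x (j, σ k)) := by
    rw [apply_inl_eq hx (σ.injective.ne hij) (σ.injective.ne hik) (σ.injective.ne hjk) (hs i),
      apply_inr_eq hx hik.symm hjk.symm hij (hs k)]
    ring
  have h := rotate hij hik hjk
  rw [rotate hjk hij.symm hik.symm, rotate hik.symm hjk.symm hij] at h
  have : x (i, σ j) = -(sgn (s i) * sgn (s i) * (sgn (s j) * sgn (s j)) *
      (sgn (s k) * sgn (s k)) * x (i, σ j)) := by linear_combination h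
  simp only [sgn_mul_self] at this
  linarith

/-- The four remaining measurements form a loop along which the value changes sign an odd number
of times. -/
theorem apply_eq_zero_of_cross (hx : x ∈ corrPolytope beta1) {i j : Fin 3}
    (hdet : ∀ m ∈ cross i j, ∃ y, x m = sgn y) {k l : Fin 3} (hik : i ≠ k) (hjl : j ≠ l) :
    x (k, l) = 0 := by
  obtain ⟨k', hik', hkk'⟩ := exists_ne_and_ne i k
  obtain ⟨l', hjl', hll'⟩ := exists_ne_and_ne j l
  have hrow (n) : ∃ y, x (i, n) = sgn y := hdet _ (by simp [cross])
  have hcol (n) : ∃ y, x (n, j) = sgn y := hdet _ (by simp [cross])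
  obtain ⟨⟨c, hc⟩, ⟨y, hy⟩, ⟨z, hz⟩⟩ := And.intro (hrow j) (And.intro (hrow l) (hcol k'))
  obtain ⟨⟨y', hy'⟩, ⟨z', hz'⟩⟩ := And.intro (hrow l') (hcol k)
  have h₁ := apply_inl_eq hx hjl hjl' hll' hz'
  have h₂ := apply_inr_eq hx hik hik' hkk' hy'
  have h₃ := apply_inl_eq hx hjl' hjl hll'.symm hz
  have h₄ := apply_inr_eq hx hik' hik hkk'.symm hy
  have hr := apply_inl_eq hx hjl hjl' hll' hc
  have hs := apply_inr_eq hx hik hik' hkk' hc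
  rw [hy, hy'] at hr
  rw [hz, hz'] at hs
  have hodd : sgn z' * sgn y' * sgn z * sgn y = -1 := by
    calc sgn z' * sgn y' * sgn z * sgn y
        = -((sgn c * sgn c) * (sgn y' * sgn y') * (sgn z * sgn z)) := by rw [hs, hr]; ring
      _ = -1 := by simp only [sgn_mul_self, mul_one]
  have : x (k, l) = sgn z' * sgn y' * sgn z * sgn y * x (k, l) := by
    rw [h₃, h₄] at h₂
    linear_combination h₁ + sgn z' * h₂
  rw [hodd] at this
  linarith

theorem vtx_inl_ne_zero_iff (a : Label1) (m : Meas) :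
    vtx (Sum.inl a) m ≠ 0 ↔ m ∈ transversal a.1 := by
  revert a m; decide +kernel

theorem vtx_inr_ne_zero_iff (a : Label2) (m : Meas) :
    vtx (Sum.inr a) m ≠ 0 ↔ m ∈ cross a.1 a.2.1 := by
  revert a m; decide +kernel

theorem exists_castV_vtx_eq_sgn (a : Label1 ⊕ Label2) {m : Meas} (h : vtx a m ≠ 0) :
    ∃ y, castV (vtx a) m = sgn y :=
  ((vtx_eq_zero_or_eq_sgnZ a m).resolve_left h).imp fun y hy => by rw [castV, hy, cast_sgnZ]

theorem eq_castV_vtx (hx : x ∈ corrPolytope beta1) {a : Label1 ⊕ Label2}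
    (h : ∀ m, vtx a m ≠ 0 → x m = castV (vtx a) m) : x = castV (vtx a) := by
  ext ⟨i, j⟩
  by_cases hm : vtx a (i, j) = 0
  swap
  · exact h _ hm
  rw [castV, hm, Int.cast_zero]
  rcases a with a | a
  · simp only [vtx_inl_ne_zero_iff] at h
    obtain ⟨k, rfl⟩ := a.1.surjective j
    have hs (l) : x (l, a.1 l) = sgn (a.2 l) := by
      rw [h _ (by simp [transversal])]
      simp [castV, vtx, vtx1, cast_sgnZ]
    refine apply_eq_zero_of_transversal hx hs fun hik => ?_
    exact (vtx_inl_ne_zero_iff a _).2 (by simp [transversal, hik]) hm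
  · have hcross := (vtx_inr_ne_zero_iff a (i, j)).not_right.1 hm
    simp only [cross, Finset.mem_filter, Finset.mem_univ, true_and, not_or] at hcross
    refine apply_eq_zero_of_cross hx (i := a.1) (j := a.2.1) (fun m hm => ?_) (Ne.symm hcross.1)
      (Ne.symm hcross.2)
    have hne := (vtx_inr_ne_zero_iff a m).2 hm
    exact h m hne ▸ exists_castV_vtx_eq_sgn _ hne

theorem castV_vtx_mem_extremePoints (a : Label1 ⊕ Label2) :
    castV (vtx a) ∈ (corrPolytope beta1).extremePoints ℝ := by
  have hmem := castV_vtx_mem_corrPolytope a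
  refine mem_extremePoints_of_onCommonFacets hmem fun x hx hface => eq_castV_vtx hx fun m hm => ?_
  obtain ⟨y, hy⟩ := exists_castV_vtx_eq_sgn a hm
  rw [hy, hface.apply_eq_sgn hmem hmem hy hy]

theorem exists_vtx2_eq : ∀ (i j : Fin 3) (r c : Fin 3 → ZMod 2), ∑ k, r k = 0 → ∑ k, c k = 1 →
    r j = c i → ∃ a, a.1 = i ∧ a.2.1 = j ∧ (∀ k, vtx2 a (i, k) = sgnZ (r k)) ∧
      ∀ k, vtx2 a (k, j) = sgnZ (c k) := by
  decide +kernel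

theorem not_forall_sum_eq_beta1 (t : Meas → ZMod 2) :
    ¬ ∀ C, ∑ k, t (ctxMeas C k) = beta1 C := by
  revert t; decide +kernel

theorem exists_eq_castV_vtx_of_mem_extremePoints
    (he : e ∈ (corrPolytope beta1).extremePoints ℝ) : ∃ a, e = castV (vtx a) := by
  rcases detSet_cases he with ⟨σ, hΩ⟩ | ⟨i, j, hΩ⟩ | hΩ
  · have hdet (i) : ∃ y, e (i, σ i) = sgn y := mem_detSet.1 (hΩ ▸ by simp [transversal])
    choose s hs using hdet
    refine ⟨Sum.inl (σ, s), eq_castV_vtx he.1 fun ⟨i, j⟩ hm => ?_⟩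
    obtain rfl : σ i = j := by simpa [transversal] using (vtx_inl_ne_zero_iff _ _).1 hm
    rw [hs]
    simp [castV, vtx, vtx1, cast_sgnZ]
  · have hrow (k) : ∃ y, e (i, k) = sgn y := mem_detSet.1 (hΩ ▸ by simp [cross])
    have hcol (k) : ∃ y, e (k, j) = sgn y := mem_detSet.1 (hΩ ▸ by simp [cross])
    choose r hr using hrow
    choose c hc using hcol
    obtain ⟨a, rfl, rfl, har, hac⟩ := exists_vtx2_eq i j r c
      (sum_eq_of_apply_eq_sgn (C := Sum.inl i) he.1 hr)
      (sum_eq_of_apply_eq_sgn (C := Sum.inr j) he.1 hc)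
      (sgn_injective ((hr j).symm.trans (hc i)))
    refine ⟨Sum.inr a, eq_castV_vtx he.1 fun ⟨k, l⟩ hm => ?_⟩
    have hm := (vtx_inr_ne_zero_iff _ _).1 hm
    simp only [cross, Finset.mem_filter, Finset.mem_univ, true_and] at hm
    rcases hm with rfl | rfl
    · rw [hr, castV, vtx, Sum.elim_inr, har, cast_sgnZ]
    · rw [hc, castV, vtx, Sum.elim_inr, hac, cast_sgnZ]
  · have hdet (m) : ∃ y, e m = sgn y := mem_detSet.1 (hΩ ▸ Finset.mem_univ m)
    choose t ht using hdet
    exact absurd (fun C => sum_eq_of_apply_eq_sgn he.1 fun k => ht (ctxMeas C k))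
      (not_forall_sum_eq_beta1 t)

end Odd

/-! ### Symmetries of the odd polytope -/

section Symmetries

variable {γ : Corr ≃ₗ[ℝ] Corr} {v w e : Corr} {τ : Equiv.Perm Meas} {ε : Meas → ZMod 2}

theorem apply_inv_apply (γ : Corr ≃ₗ[ℝ] Corr) (e : Corr) : γ (γ⁻¹ e) = e :=
  γ.apply_symm_apply e

theorem inv_apply_apply (γ : Corr ≃ₗ[ℝ] Corr) (e : Corr) : γ⁻¹ (γ e) = e :=
  γ.symm_apply_apply e

/-- The group of the linear isometries that preserve the odd polytope. -/
def symGroup : Subgroup (Corr ≃ₗ[ℝ] Corr) where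
  carrier := {γ | (∀ e, γ e ∈ corrPolytope beta1 ↔ e ∈ corrPolytope beta1) ∧
    ∀ u v, γ u ⬝ᵥ γ v = u ⬝ᵥ v}
  one_mem' := ⟨fun _ => Iff.rfl, fun _ _ => rfl⟩
  mul_mem' hγ hδ := ⟨fun e => (hγ.1 _).trans (hδ.1 e), fun u v => (hγ.2 _ _).trans (hδ.2 u v)⟩
  inv_mem' hγ := ⟨fun e => by rw [← hγ.1, apply_inv_apply],
    fun u v => by rw [← hγ.2, apply_inv_apply, apply_inv_apply]⟩

theorem image_corrPolytope (hγ : γ ∈ symGroup) :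
    γ '' corrPolytope beta1 = corrPolytope beta1 := by
  rw [show (⇑γ '' corrPolytope beta1) = γ.toEquiv '' corrPolytope beta1 from rfl,
    Equiv.image_eq_preimage_symm]
  ext e
  exact (hγ.1 (γ.symm e)).symm.trans (by rw [γ.apply_symm_apply])

theorem map_mem_extremePoints (hγ : γ ∈ symGroup) :
    γ v ∈ (corrPolytope beta1).extremePoints ℝ ↔ v ∈ (corrPolytope beta1).extremePoints ℝ := by
  have h := extremePoints_image (P := corrPolytope beta1) γ.toLinearMap.toAffineMap γ.injective
  have hcoe : ⇑γ.toLinearMap.toAffineMap = γ := rfl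
  rw [hcoe, image_corrPolytope hγ] at h
  exact (Set.ext_iff.1 h (γ v)).trans γ.injective.mem_set_image

theorem isExposed_segment_map (hγ : γ ∈ symGroup)
    (h : IsExposed ℝ (corrPolytope beta1) (segment ℝ v w)) :
    IsExposed ℝ (corrPolytope beta1) (segment ℝ (γ v) (γ w)) := by
  have h := isExposed_image_of_leftInverse γ.toLinearMap.toAffineMap
    (LinearMap.toContinuousLinearMap γ.symm.toLinearMap) γ.symm_apply_apply h
  have hcoe : ⇑γ.toLinearMap.toAffineMap = γ := rfl
  rwa [image_segment, hcoe, image_corrPolytope hγ] at h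

/-- The signed permutation `γ` of the coordinates with `(γ e) (τ m) = (-1)^(ε m) e m`. -/
def signedPerm (τ : Equiv.Perm Meas) (ε : Meas → ZMod 2) : Corr ≃ₗ[ℝ] Corr where
  toFun e := fun m => sgn (ε (τ.symm m)) * e (τ.symm m)
  invFun e := fun m => sgn (ε m) * e (τ m)
  map_add' x y := by ext m; simp [mul_add]
  map_smul' r x := by ext m; simp [mul_left_comm]
  left_inv e := by ext m; simp [← mul_assoc, sgn_mul_self]
  right_inv e := by ext m; simp [← mul_assoc, sgn_mul_self]

theorem signedPerm_apply (τ : Equiv.Perm Meas) (ε : Meas → ZMod 2) (e : Corr) (m : Meas) :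
    signedPerm τ ε e (τ m) = sgn (ε m) * e m := by
  simp [signedPerm]

theorem signedPerm_mul (τ τ' : Equiv.Perm Meas) (ε ε' : Meas → ZMod 2) :
    signedPerm τ ε * signedPerm τ' ε' = signedPerm (τ * τ') (fun m => ε' m + ε (τ' m)) := by
  ext e m
  obtain ⟨m, rfl⟩ := (τ * τ').surjective m
  rw [signedPerm_apply, LinearEquiv.mul_apply, Equiv.Perm.mul_apply, signedPerm_apply,
    signedPerm_apply, sgn_add]
  ring

theorem signedPerm_dotProduct (u v : Corr) : signedPerm τ ε u ⬝ᵥ signedPerm τ ε v = u ⬝ᵥ v := by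
  rw [dotProduct, dotProduct, ← Equiv.sum_comp τ]
  refine Finset.sum_congr rfl fun m _ => ?_
  rw [signedPerm_apply, signedPerm_apply]
  linear_combination (u m * v m) * sgn_mul_self (ε m)

/-- The signed permutation given by `τ` and `ε` takes the context `C` to the context `C'`, and its
signs account for the change of `β₁`. -/
def MapsCtx (τ : Equiv.Perm Meas) (ε : Meas → ZMod 2) (C C' : Ctx) : Prop :=
  (∃ π : Equiv.Perm (Fin 3), ∀ k, τ (ctxMeas C k) = ctxMeas C' (π k)) ∧
    beta1 C' = beta1 C + ∑ k, ε (ctxMeas C k)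

instance (C C' : Ctx) : Decidable (MapsCtx τ ε C C') := by unfold MapsCtx; infer_instance

theorem MapsCtx.forall_neg_one_le_row_iff {C C' : Ctx} (h : MapsCtx τ ε C C') :
    (∀ s, ∑ k, s k = beta1 C' → -1 ≤ row C' s (signedPerm τ ε e)) ↔
      ∀ s, ∑ k, s k = beta1 C → -1 ≤ row C s e := by
  obtain ⟨⟨π, hπ⟩, hβ⟩ := h
  have hrow (s : Fin 3 → ZMod 2) : row C' s (signedPerm τ ε e) =
      row C (fun k => s (π k) + ε (ctxMeas C k)) e := by
    simp only [row_apply]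
    rw [← Equiv.sum_comp π]
    exact Finset.sum_congr rfl fun k _ => by rw [← hπ, signedPerm_apply, sgn_add, mul_assoc]
  have hsum (s : Fin 3 → ZMod 2) : ∑ k, (s (π k) + ε (ctxMeas C k)) = beta1 C ↔
      ∑ k, s k = beta1 C' := by
    rw [Finset.sum_add_distrib, Equiv.sum_comp π s, hβ, CharTwo.add_eq_iff_eq_add]
  refine ⟨fun h s hs => ?_, fun h s hs => hrow s ▸ h _ ((hsum s).2 hs)⟩
  obtain ⟨t, rfl⟩ : ∃ t : Fin 3 → ZMod 2, s = fun k => t (π k) + ε (ctxMeas C k) :=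
    ⟨fun k => s (π.symm k) + ε (ctxMeas C (π.symm k)), by
      ext k; simp [add_assoc, CharTwo.add_self_eq_zero]⟩
  exact hrow t ▸ h t ((hsum t).1 hs)

theorem signedPerm_mem_symGroup (h : ∀ C, ∃ C', MapsCtx τ ε C C')
    (h' : ∀ C', ∃ C, MapsCtx τ ε C C') : signedPerm τ ε ∈ symGroup := by
  have hiff {C C' : Ctx} (hC : MapsCtx τ ε C C') (e : Corr) :=
    hC.forall_neg_one_le_row_iff (e := e)
  refine ⟨fun e => ⟨fun he ⟨⟨C, s⟩, hs⟩ => ?_, fun he ⟨⟨C', s⟩, hs⟩ => ?_⟩, signedPerm_dotProduct⟩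
  · obtain ⟨C', hC⟩ := h C
    exact (hiff hC e).1 (fun _ => neg_one_le_row he) s hs
  · obtain ⟨C, hC⟩ := h' C'
    exact (hiff hC e).2 (fun _ => neg_one_le_row he) s hs

end Symmetries

/-! ### Symmetries from pairs of rotations of the cube -/

/-- The rotations of the cube, as signed permutations of the three axes with determinant one; the
rotation `⟨(π, ε), _⟩` takes the unit vector `a` to `(-1)^(ε a)` times the unit vector `π a`. -/
abbrev Rot : Type :=
  {r : Equiv.Perm (Fin 3) × (Fin 3 → ZMod 2) // (Equiv.Perm.sign r.1 : ℤ) = sgnZ (∑ a, r.2 a)}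

/-- The permutation of the axes. -/
def Rot.perm (r : Rot) : Equiv.Perm (Fin 3) := r.1.1

/-- The signs of the axes. -/
def Rot.sign (r : Rot) : Fin 3 → ZMod 2 := r.1.2

instance : One Rot := ⟨⟨(1, 0), by decide⟩⟩

instance : Mul Rot where
  mul r r' := ⟨(r.perm * r'.perm, fun a => r'.sign a + r.sign (r'.perm a)), by
    change (Equiv.Perm.sign (r.perm * r'.perm) : ℤ) = _
    have hr : (Equiv.Perm.sign r.perm : ℤ) = sgnZ (∑ a, r.sign a) := r.2
    have hr' : (Equiv.Perm.sign r'.perm : ℤ) = sgnZ (∑ a, r'.sign a) := r'.2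
    rw [map_mul, Units.val_mul, Finset.sum_add_distrib, Equiv.sum_comp r'.perm r.sign, sgnZ_add,
      hr, hr', mul_comm]⟩

theorem Rot.perm_one : (1 : Rot).perm = 1 := rfl

theorem Rot.sign_one : (1 : Rot).sign = 0 := rfl

theorem Rot.perm_mul (r r' : Rot) : (r * r').perm = r.perm * r'.perm := rfl

theorem Rot.sign_mul (r r' : Rot) (a : Fin 3) :
    (r * r').sign a = r'.sign a + r.sign (r'.perm a) := rfl

instance : Monoid Rot where
  mul_assoc r r' r'' := Subtype.ext <| Prod.ext rfl <| funext fun a => (add_assoc _ _ _).symm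
  one_mul r := Subtype.ext <| Prod.ext rfl <| funext fun a => add_zero _
  mul_one r := Subtype.ext <| Prod.ext rfl <| funext fun a => zero_add _

/-- If `pauliIdx m = (a, b)`, then the measurement `m` is the tensor product of the Pauli matrices
with the indices `a` and `b`. Each context is then the graph of a permutation of the indices: an
odd one for the horizontal contexts and an even one for the vertical contexts. -/
def pauliIdx : Meas ≃ Fin 3 × Fin 3 where
  toFun m := (m.2 - m.1, -m.1 - m.2)
  invFun a := (a.1 + a.2, a.2 - a.1)
  left_inv := by decide
  right_inv := by decide

/-- The permutation of the measurements given by two rotations. -/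
def rotPerm (r r' : Rot) : Equiv.Perm Meas :=
  (pauliIdx.trans (Equiv.prodCongr r.perm r'.perm)).trans pauliIdx.symm

/-- The signs given by two rotations. -/
def rotSign (r r' : Rot) (m : Meas) : ZMod 2 :=
  r.sign (pauliIdx m).1 + r'.sign (pauliIdx m).2

/-- The permutation of the measurements given by the exchange of the qubits. -/
def swapPerm : Equiv.Perm Meas := (pauliIdx.trans (Equiv.prodComm _ _)).trans pauliIdx.symm

theorem rotPerm_mapsCtx_left : ∀ r : Rot, (∀ C, ∃ C', MapsCtx (rotPerm r 1) (rotSign r 1) C C') ∧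
    ∀ C', ∃ C, MapsCtx (rotPerm r 1) (rotSign r 1) C C' := by
  decide +kernel

theorem rotPerm_mapsCtx_right : ∀ r : Rot, (∀ C, ∃ C', MapsCtx (rotPerm 1 r) (rotSign 1 r) C C') ∧
    ∀ C', ∃ C, MapsCtx (rotPerm 1 r) (rotSign 1 r) C C' := by
  decide +kernel

theorem swapPerm_mapsCtx : (∀ C, ∃ C', MapsCtx swapPerm 0 C C') ∧
    ∀ C', ∃ C, MapsCtx swapPerm 0 C C' := by
  decide +kernel

theorem swapPerm_mem_symGroup : signedPerm swapPerm 0 ∈ symGroup :=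
  signedPerm_mem_symGroup swapPerm_mapsCtx.1 swapPerm_mapsCtx.2

theorem rotPerm_mem_symGroup (r r' : Rot) :
    signedPerm (rotPerm r r') (rotSign r r') ∈ symGroup := by
  have h := mul_mem
    (signedPerm_mem_symGroup (rotPerm_mapsCtx_left r).1 (rotPerm_mapsCtx_left r).2)
    (signedPerm_mem_symGroup (rotPerm_mapsCtx_right r').1 (rotPerm_mapsCtx_right r').2)
  rw [signedPerm_mul] at h
  convert h using 2
  · ext1 m
    simp [rotPerm, Rot.perm_one, Prod.map]
  · ext1 m
    simp [rotSign, rotPerm, Rot.perm_one, Rot.sign_one, add_comm]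

/-- Codes for the symmetries given by two rotations, followed by the exchange of the qubits if
the first component is `true`. -/
abbrev SymCode : Type := Bool × Rot × Rot

/-- The permutation of the measurements. -/
def SymCode.perm (g : SymCode) : Equiv.Perm Meas :=
  if g.1 then swapPerm * rotPerm g.2.1 g.2.2 else rotPerm g.2.1 g.2.2

/-- The signs of the measurements. -/
def SymCode.sign (g : SymCode) : Meas → ZMod 2 := rotSign g.2.1 g.2.2

/-- The symmetry with a given code. -/
def SymCode.toSym (g : SymCode) : Corr ≃ₗ[ℝ] Corr := signedPerm g.perm g.sign

theorem SymCode.toSym_eq (g : SymCode) : g.toSym = if g.1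
    then signedPerm swapPerm 0 * signedPerm (rotPerm g.2.1 g.2.2) (rotSign g.2.1 g.2.2)
    else signedPerm (rotPerm g.2.1 g.2.2) (rotSign g.2.1 g.2.2) := by
  rw [toSym, perm, sign]
  split_ifs
  · rw [signedPerm_mul]; congr 1; ext m; simp
  · rfl

/-! ### Pauli operators -/

/-- The Pauli matrices. -/
def pauli : Fin 3 → Op1 := ![X, Y, Z]

theorem pauli_mul_self (a : Fin 3) : pauli a * pauli a = 1 := by
  fin_cases a <;> ext i j <;> fin_cases i <;> fin_cases j <;>
    simp [pauli, X, Y, Z, Matrix.mul_apply, Fin.sum_univ_two]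

theorem trace_pauli (a : Fin 3) : (pauli a).trace = 0 := by
  fin_cases a <;> simp [pauli, X, Y, Z, Matrix.trace, Fin.sum_univ_two]

theorem trace_pauli_mul_pauli (a b : Fin 3) :
    (pauli a * pauli b).trace = if a = b then 2 else 0 := by
  fin_cases a <;> fin_cases b <;>
    simp [pauli, X, Y, Z, Matrix.trace, Fin.sum_univ_two] <;> norm_num

theorem pauli_mul_pauli_mul_pauli (π : Equiv.Perm (Fin 3)) :
    pauli (π 0) * pauli (π 1) * pauli (π 2) =
      ((Equiv.Perm.sign π : ℤ) * Complex.I : ℂ) • (1 : Op1) := by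
  have hcyc : ∃ c, ((Equiv.Perm.sign π : ℤ) = 1 ∧ π 0 = c ∧ π 1 = c + 1 ∧ π 2 = c + 2) ∨
      ((Equiv.Perm.sign π : ℤ) = -1 ∧ π 0 = c ∧ π 1 = c - 1 ∧ π 2 = c - 2) := by
    revert π; decide
  obtain ⟨c, ⟨hπ, h0, h1, h2⟩ | ⟨hπ, h0, h1, h2⟩⟩ := hcyc <;> rw [hπ, h0, h1, h2] <;>
    fin_cases c <;> ext i j <;> fin_cases i <;> fin_cases j <;>
    simp [pauli, X, Y, Z, Matrix.mul_apply, Fin.sum_univ_two]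

theorem pauliSquare_eq (m : Meas) :
    pauliSquare m.1 m.2 = pauli (pauliIdx m).1 ⊗ₖ pauli (pauliIdx m).2 := by
  obtain ⟨i, j⟩ := m
  fin_cases i <;> fin_cases j <;> rfl

theorem trace_pauliSquare (m : Meas) : (pauliSquare m.1 m.2).trace = 0 := by
  rw [pauliSquare_eq, Matrix.trace_kronecker, trace_pauli, zero_mul]

theorem trace_pauliSquare_mul (m n : Meas) :
    (pauliSquare m.1 m.2 * pauliSquare n.1 n.2).trace = if m = n then 4 else 0 := by
  rw [pauliSquare_eq, pauliSquare_eq, ← Matrix.mul_kronecker_mul, Matrix.trace_kronecker,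
    trace_pauli_mul_pauli, trace_pauli_mul_pauli]
  by_cases h : m = n
  · subst h; norm_num
  · have h' : pauliIdx m ≠ pauliIdx n := fun h' => h (pauliIdx.injective h')
    rw [Ne, Prod.ext_iff, not_and_or] at h'
    rcases h' with h' | h' <;> simp [h, h']

/-- The operator with given expectation values. -/
def opOf (e : Corr) : Op2 := (1 / 4 : ℂ) • (1 + ∑ m : Meas, (e m : ℂ) • pauliSquare m.1 m.2)

theorem toOp_eq (p : Dist) : toOp p = opOf (expect p) := rfl

theorem trace_opOf_mul (e : Corr) (n : Meas) : (opOf e * pauliSquare n.1 n.2).trace = e n := by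
  simp only [opOf, Matrix.smul_mul, Matrix.trace_smul, add_mul, one_mul, Matrix.trace_add,
    trace_pauliSquare, Finset.sum_mul, Matrix.trace_sum, trace_pauliSquare_mul, smul_eq_mul,
    zero_add, mul_ite, mul_zero, Finset.sum_ite_eq', Finset.mem_univ, if_true]
  ring

theorem opOf_injective : Function.Injective opOf := fun e e' h => by
  ext n
  have := trace_opOf_mul e n
  rw [h, trace_opOf_mul] at this
  exact_mod_cast this.symm

/-! ### One-qubit Clifford unitaries as rotations -/

section Clifford

variable {U V : Op1} {r r' : Rot}

/-- Conjugation by `U` acts on the Pauli matrices as the rotation `r`. -/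
def ActsAs (U : Op1) (r : Rot) : Prop :=
  ∀ a, U * pauli a * star U = (sgn (r.sign a) : ℂ) • pauli (r.perm a)

theorem conj_mul_conj (hU : U ∈ Matrix.unitaryGroup (Fin 2) ℂ) (A B : Op1) :
    U * A * star U * (U * B * star U) = U * (A * B) * star U := by
  calc U * A * star U * (U * B * star U) = U * A * (star U * U) * B * star U := by noncomm_ring
    _ = U * (A * B) * star U := by rw [Matrix.mem_unitaryGroup_iff'.1 hU]; noncomm_ring

theorem conj_smul_one (hU : U ∈ Matrix.unitaryGroup (Fin 2) ℂ) (c : ℂ) :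
    U * (c • (1 : Op1)) * star U = c • (1 : Op1) := by
  rw [Matrix.mul_smul, Matrix.smul_mul, mul_one, Matrix.mem_unitaryGroup_iff.1 hU]

theorem trace_conj (hU : U ∈ Matrix.unitaryGroup (Fin 2) ℂ) (A : Op1) :
    (U * A * star U).trace = A.trace := by
  rw [Matrix.trace_mul_comm, ← mul_assoc, Matrix.mem_unitaryGroup_iff'.1 hU, one_mul]

theorem smul_one_injective : Function.Injective fun c : ℂ => c • (1 : Op1) :=
  smul_left_injective ℂ one_ne_zero

theorem mem_pauliSet_iff {B : Op1} :
    B ∈ ({1, X, Y, Z} : Set Op1) ↔ B = 1 ∨ ∃ a, B = pauli a := by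
  simp [Fin.exists_fin_succ, pauli]

theorem IsClifford.exists_sgn_smul_pauli (hU : IsClifford U) (a : Fin 3) :
    ∃ b s, U * pauli a * star U = (sgn s : ℂ) • pauli b := by
  obtain ⟨k, B, hB, h⟩ := hU.2 (pauli a) ⟨0, pauli a, mem_pauliSet_iff.2 (Or.inr ⟨a, rfl⟩), by simp⟩
  have htrace : (Complex.I ^ k • B).trace = 0 := by rw [← h, trace_conj hU.1, trace_pauli]
  rcases mem_pauliSet_iff.1 hB with rfl | ⟨b, rfl⟩
  · simp [Matrix.trace_smul] at htrace
  have hsq : Complex.I ^ k * Complex.I ^ k = 1 := by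
    have hmul := conj_mul_conj hU.1 (pauli a) (pauli a)
    rw [pauli_mul_self, mul_one, Matrix.mem_unitaryGroup_iff.1 hU.1, h, Matrix.smul_mul,
      Matrix.mul_smul, pauli_mul_self, smul_smul] at hmul
    exact smul_one_injective (hmul.trans (one_smul ℂ _).symm)
  rcases mul_self_eq_one_iff.1 hsq with hk | hk
  · exact ⟨b, 0, by simp [h, hk, sgn_zero]⟩
  · exact ⟨b, 1, by simp [h, hk, sgn_one]⟩

theorem injective_of_conj_pauli_eq (hU : U ∈ Matrix.unitaryGroup (Fin 2) ℂ) {f : Fin 3 → Fin 3}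
    {s : Fin 3 → ZMod 2} (h : ∀ a, U * pauli a * star U = (sgn (s a) : ℂ) • pauli (f a)) :
    Function.Injective f := by
  intro a b hab
  by_contra hne
  have hmul := conj_mul_conj hU (pauli a) (pauli b)
  rw [h, h, hab, Matrix.smul_mul, Matrix.mul_smul, pauli_mul_self, smul_smul] at hmul
  have htrace := congrArg Matrix.trace hmul
  rw [trace_conj hU, trace_pauli_mul_pauli, if_neg hne] at htrace
  simp [sgn_ne_zero] at htrace

/-- The relation `XYZ = i` fixes the sign of the permutation. -/
theorem sign_eq_of_conj_pauli_eq (hU : U ∈ Matrix.unitaryGroup (Fin 2) ℂ)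
    {π : Equiv.Perm (Fin 3)} {s : Fin 3 → ZMod 2}
    (h : ∀ a, U * pauli a * star U = (sgn (s a) : ℂ) • pauli (π a)) :
    (Equiv.Perm.sign π : ℤ) = sgnZ (∑ a, s a) := by
  have hXYZ : pauli 0 * pauli 1 * pauli 2 = Complex.I • (1 : Op1) := by
    simpa using pauli_mul_pauli_mul_pauli 1
  have hconj := conj_smul_one hU Complex.I
  rw [← hXYZ, ← conj_mul_conj hU, ← conj_mul_conj hU, h, h, h] at hconj
  simp only [Matrix.smul_mul, Matrix.mul_smul, pauli_mul_pauli_mul_pauli, smul_smul] at hconj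
  rw [hXYZ] at hconj
  have hprod : sgnZ (∑ a, s a) * (Equiv.Perm.sign π : ℤ) = 1 := by
    rw [Fin.sum_univ_three, sgnZ_add, sgnZ_add]
    refine Int.cast_injective (α := ℂ) (mul_right_cancel₀ Complex.I_ne_zero ?_)
    have h := smul_one_injective hconj
    simp only [← cast_sgnZ] at h
    push_cast at h ⊢
    linear_combination h
  exact (Int.eq_of_mul_eq_one hprod).symm

theorem IsClifford.exists_actsAs (hU : IsClifford U) : ∃ r, ActsAs U r := by
  choose f s h using hU.exists_sgn_smul_pauli
  let π : Equiv.Perm (Fin 3) := Equiv.ofBijective f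
    (Finite.injective_iff_bijective.1 (injective_of_conj_pauli_eq hU.1 h))
  exact ⟨⟨(π, s), sign_eq_of_conj_pauli_eq (π := π) hU.1 h⟩, h⟩

theorem ActsAs.isClifford (hU : U ∈ Matrix.unitaryGroup (Fin 2) ℂ) (h : ActsAs U r) :
    IsClifford U := by
  refine ⟨hU, ?_⟩
  rintro _ ⟨k, B, hB, rfl⟩
  rcases mem_pauliSet_iff.1 hB with rfl | ⟨a, rfl⟩
  · exact ⟨k, 1, hB, conj_smul_one hU _⟩
  · refine ⟨k + 2 * (r.sign a).val, pauli (r.perm a), mem_pauliSet_iff.2 (Or.inr ⟨_, rfl⟩), ?_⟩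
    rw [Matrix.mul_smul, Matrix.smul_mul, h a, smul_smul, pow_add, pow_mul, Complex.I_sq, sgn]
    push_cast
    rfl

theorem ActsAs.one : ActsAs 1 1 := fun a => by
  simp [Rot.perm_one, Rot.sign_one, sgn_zero]

theorem ActsAs.mul (h : ActsAs U r) (h' : ActsAs V r') : ActsAs (U * V) (r * r') := by
  intro a
  have hconj : U * V * pauli a * star (U * V) = U * (V * pauli a * star V) * star U := by
    rw [star_mul]; noncomm_ring
  rw [hconj, h' a, Matrix.mul_smul, Matrix.smul_mul, h, smul_smul, Rot.perm_mul, Rot.sign_mul,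
    sgn_add, Complex.ofReal_mul, Equiv.Perm.mul_apply]

theorem ActsAs.pow (h : ActsAs U r) : ∀ n : ℕ, ActsAs (U ^ n) (r ^ n)
  | 0 => .one
  | n + 1 => by rw [pow_succ, pow_succ]; exact (h.pow n).mul h

/-- The phase gate. -/
def phaseGate : Op1 := !![1, 0; 0, Complex.I]

/-- The Clifford unitary that permutes the Pauli matrices cyclically. -/
def cycleGate : Op1 :=
  !![(1 - Complex.I) / 2, (-1 - Complex.I) / 2; (1 - Complex.I) / 2, (1 + Complex.I) / 2]

/-- The rotation of the phase gate. -/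
def phaseRot : Rot := ⟨(Equiv.swap 0 1, ![0, 1, 0]), by decide⟩

/-- The rotation of the cyclic gate. -/
def cycleRot : Rot := ⟨(Equiv.addRight 1, 0), by decide⟩

theorem phaseGate_mem_unitaryGroup : phaseGate ∈ Matrix.unitaryGroup (Fin 2) ℂ := by
  rw [Matrix.mem_unitaryGroup_iff]
  ext i j
  fin_cases i <;> fin_cases j <;>
    simp [phaseGate, Matrix.mul_apply, Fin.sum_univ_two, Matrix.star_apply]

theorem star_cycleGate : star cycleGate =
    !![(1 + Complex.I) / 2, (1 + Complex.I) / 2; (-1 + Complex.I) / 2, (1 - Complex.I) / 2] := by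
  ext i j
  fin_cases i <;> fin_cases j <;>
    simp [cycleGate, Matrix.star_apply, sub_eq_add_neg]

theorem cycleGate_mem_unitaryGroup : cycleGate ∈ Matrix.unitaryGroup (Fin 2) ℂ := by
  have hI := Complex.I_sq
  rw [Matrix.mem_unitaryGroup_iff, star_cycleGate]
  ext i j
  fin_cases i <;> fin_cases j <;>
    simp [cycleGate, Matrix.mul_apply, Fin.sum_univ_two] <;> grind

theorem actsAs_phaseGate : ActsAs phaseGate phaseRot := by
  intro a
  fin_cases a <;> ext i j <;> fin_cases i <;> fin_cases j <;>
    simp [phaseGate, phaseRot, Rot.sign, Rot.perm, pauli, X, Y, Z, Matrix.mul_apply,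
      Fin.sum_univ_two, Matrix.star_apply, sgn_zero, sgn_one, Equiv.swap_apply_def]

theorem actsAs_cycleGate : ActsAs cycleGate cycleRot := by
  have hI := Complex.I_sq
  intro a
  rw [star_cycleGate]
  fin_cases a <;> ext i j <;> fin_cases i <;> fin_cases j <;>
    simp [cycleGate, cycleRot, Rot.sign, Rot.perm, pauli, X, Y, Z, Matrix.mul_apply,
      Fin.sum_univ_two, sgn_zero] <;> grind

theorem exists_eq_cycleRot_pow_mul : ∀ r : Rot, ∃ a c : Fin 3, ∃ b d : Fin 4,
    r = cycleRot ^ a.val * phaseRot ^ b.val * cycleRot ^ c.val * phaseRot ^ d.val := by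
  decide +kernel

theorem exists_isClifford_actsAs (r : Rot) : ∃ U, IsClifford U ∧ ActsAs U r := by
  obtain ⟨a, c, b, d, rfl⟩ := exists_eq_cycleRot_pow_mul r
  have hcyc := cycleGate_mem_unitaryGroup
  have hphase := phaseGate_mem_unitaryGroup
  have hact := (((actsAs_cycleGate.pow a).mul (actsAs_phaseGate.pow b)).mul
    (actsAs_cycleGate.pow c)).mul (actsAs_phaseGate.pow d)
  exact ⟨_, hact.isClifford (mul_mem (mul_mem (mul_mem (pow_mem hcyc _) (pow_mem hphase _))
    (pow_mem hcyc _)) (pow_mem hphase _)), hact⟩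

end Clifford

/-! ### The group `G₁` and the symmetries of the odd polytope -/

/-- The algebra automorphism `g` acts on the operators of correlation vectors as `γ`. -/
def Implements (g : Op2 ≃ₐ[ℂ] Op2) (γ : Corr ≃ₗ[ℝ] Corr) : Prop := ∀ e, g (opOf e) = opOf (γ e)

section Implements

variable {g g' : Op2 ≃ₐ[ℂ] Op2} {γ γ' : Corr ≃ₗ[ℝ] Corr}
  {W : Matrix.unitaryGroup (Fin 2 × Fin 2) ℂ}

theorem Implements.mul (h : Implements g γ) (h' : Implements g' γ') :
    Implements (g * g') (γ * γ') := fun e => by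
  rw [AlgEquiv.mul_apply, h', h, LinearEquiv.mul_apply]

theorem Implements.inv (h : Implements g γ) : Implements g⁻¹ γ⁻¹ := fun e => by
  have hinv : g (opOf (γ⁻¹ e)) = opOf e := by rw [h, apply_inv_apply]
  rw [← hinv, ← AlgEquiv.mul_apply, inv_mul_cancel, AlgEquiv.one_apply]

theorem implements_signedPerm {τ : Equiv.Perm Meas} {ε : Meas → ZMod 2}
    (h : ∀ m : Meas, g (pauliSquare m.1 m.2) = (sgn (ε m) : ℂ) • pauliSquare (τ m).1 (τ m).2) :
    Implements g (signedPerm τ ε) := by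
  intro e
  rw [opOf, opOf, map_smul, map_add, map_one, map_sum]
  congr 2
  rw [← Equiv.sum_comp τ fun m => ((signedPerm τ ε e m : ℝ) : ℂ) • pauliSquare m.1 m.2]
  refine Finset.sum_congr rfl fun m _ => ?_
  rw [map_smul, h, smul_smul, signedPerm_apply, Complex.ofReal_mul, mul_comm]

theorem conj_apply (A : Op2) : conj W A = W * A * star (W : Op2) := rfl

theorem star_kronecker (U V : Op1) : star (U ⊗ₖ V) = star U ⊗ₖ star V :=
  Matrix.conjTranspose_kronecker U V

theorem implements_kronecker {U V : Op1} {r r' : Rot} (hU : ActsAs U r) (hV : ActsAs V r')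
    (hW : (W : Op2) = U ⊗ₖ V) :
    Implements (conj W) (signedPerm (rotPerm r r') (rotSign r r')) := by
  refine implements_signedPerm fun m => ?_
  have hidx : pauliIdx (rotPerm r r' m) = (r.perm (pauliIdx m).1, r'.perm (pauliIdx m).2) := by
    simp [rotPerm, Prod.map]
  rw [conj_apply, hW, pauliSquare_eq, pauliSquare_eq, hidx, star_kronecker,
    ← Matrix.mul_kronecker_mul, ← Matrix.mul_kronecker_mul, hU, hV, Matrix.smul_kronecker,
    Matrix.kronecker_smul, smul_smul, rotSign, sgn_add, Complex.ofReal_mul]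

theorem swapOp_mul_kronecker_mul (A B : Op1) :
    swapOp * (A ⊗ₖ B) * star swapOp = B ⊗ₖ A := by
  ext ⟨i, j⟩ ⟨k, l⟩
  simp only [Matrix.mul_apply, swapOp, Matrix.star_apply, Matrix.of_apply, Fintype.sum_prod_type,
    Fin.sum_univ_two, Matrix.kroneckerMap_apply, Prod.swap_prod_mk]
  fin_cases i <;> fin_cases j <;> fin_cases k <;> fin_cases l <;> simp [mul_comm]

theorem implements_swap (hW : (W : Op2) = swapOp) :
    Implements (conj W) (signedPerm swapPerm 0) := by
  refine implements_signedPerm fun m => ?_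
  have hidx : pauliIdx (swapPerm m) = ((pauliIdx m).2, (pauliIdx m).1) := by
    simp [swapPerm, Prod.swap]
  rw [conj_apply, hW, pauliSquare_eq, pauliSquare_eq, hidx, swapOp_mul_kronecker_mul,
    Pi.zero_apply, sgn_zero, Complex.ofReal_one, one_smul]

theorem exists_implements_of_mem_G1 (hg : g ∈ G1) : ∃ γ ∈ symGroup, Implements g γ := by
  obtain ⟨W, hW, rfl⟩ := hg
  induction hW using Subgroup.closure_induction with
  | mem W hW =>
    rcases hW with ⟨U, V, hU, hV, hW⟩ | hW
    · obtain ⟨r, hr⟩ := hU.exists_actsAs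
      obtain ⟨r', hr'⟩ := hV.exists_actsAs
      exact ⟨_, rotPerm_mem_symGroup r r', implements_kronecker hr hr' hW⟩
    · exact ⟨_, swapPerm_mem_symGroup, implements_swap hW⟩
  | one => exact ⟨1, one_mem _, fun e => by rw [map_one]; rfl⟩
  | mul _ _ _ _ ih ih' =>
    obtain ⟨γ, hγ, h⟩ := ih
    obtain ⟨γ', hγ', h'⟩ := ih'
    exact ⟨γ * γ', mul_mem hγ hγ', by rw [map_mul]; exact h.mul h'⟩
  | inv _ _ ih =>
    obtain ⟨γ, hγ, h⟩ := ih
    exact ⟨γ⁻¹, inv_mem hγ, by rw [map_inv]; exact h.inv⟩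

/-- The symmetries of the odd polytope that are implemented by elements of `G₁`. -/
def implGroup : Subgroup (Corr ≃ₗ[ℝ] Corr) where
  carrier := {γ | γ ∈ symGroup ∧ ∃ g ∈ G1, Implements g γ}
  one_mem' := ⟨one_mem _, 1, one_mem _, fun _ => rfl⟩
  mul_mem' := fun ⟨h, g, hg, hi⟩ ⟨h', g', hg', hi'⟩ =>
    ⟨mul_mem h h', g * g', mul_mem hg hg', hi.mul hi'⟩
  inv_mem' := fun ⟨h, g, hg, hi⟩ => ⟨inv_mem h, g⁻¹, inv_mem hg, hi.inv⟩

theorem kronecker_mem_unitaryGroup {U V : Op1} (hU : U ∈ Matrix.unitaryGroup (Fin 2) ℂ)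
    (hV : V ∈ Matrix.unitaryGroup (Fin 2) ℂ) :
    U ⊗ₖ V ∈ Matrix.unitaryGroup (Fin 2 × Fin 2) ℂ := by
  rw [Matrix.mem_unitaryGroup_iff, star_kronecker, ← Matrix.mul_kronecker_mul,
    Matrix.mem_unitaryGroup_iff.1 hU, Matrix.mem_unitaryGroup_iff.1 hV, Matrix.one_kronecker_one]

theorem swapOp_mem_unitaryGroup : swapOp ∈ Matrix.unitaryGroup (Fin 2 × Fin 2) ℂ := by
  have h := swapOp_mul_kronecker_mul 1 1
  rwa [Matrix.one_kronecker_one, mul_one, ← Matrix.mem_unitaryGroup_iff] at h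

theorem rotPerm_mem_implGroup (r r' : Rot) :
    signedPerm (rotPerm r r') (rotSign r r') ∈ implGroup := by
  obtain ⟨U, hU, hr⟩ := exists_isClifford_actsAs r
  obtain ⟨V, hV, hr'⟩ := exists_isClifford_actsAs r'
  exact ⟨rotPerm_mem_symGroup r r', conj ⟨_, kronecker_mem_unitaryGroup hU.1 hV.1⟩,
    ⟨_, Subgroup.subset_closure (Or.inl ⟨U, V, hU, hV, rfl⟩), rfl⟩,
    implements_kronecker hr hr' rfl⟩

theorem swapPerm_mem_implGroup : signedPerm swapPerm 0 ∈ implGroup :=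
  ⟨swapPerm_mem_symGroup, conj ⟨_, swapOp_mem_unitaryGroup⟩,
    ⟨_, Subgroup.subset_closure (Or.inr rfl), rfl⟩, implements_swap rfl⟩

theorem SymCode.toSym_mem_implGroup (g : SymCode) : g.toSym ∈ implGroup := by
  rw [toSym_eq]
  split_ifs
  · exact mul_mem swapPerm_mem_implGroup (rotPerm_mem_implGroup _ _)
  · exact rotPerm_mem_implGroup _ _

end Implements

/-! ### Orbits of vertices and of pairs of vertices -/

/-- The label of the vertex `q₀`. -/
def q0 : Label1 ⊕ Label2 := Sum.inl (Equiv.swap 0 2, ![0, 0, 1])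

/-- The label of the vertex `q₁`. -/
def q1 : Label1 ⊕ Label2 := Sum.inl (Equiv.addLeft 2, ![1, 0, 0])

/-- The label of the vertex `p₀`. -/
def p0 : Label1 ⊕ Label2 := Sum.inr (1, 0, 0, 0, 1)

/-- The label of the vertex `p₁`. -/
def p1 : Label1 ⊕ Label2 := Sum.inr (0, 1, 1, 1, 0)

/-- The label of the vertex `p₂`. -/
def p2 : Label1 ⊕ Label2 := Sum.inr (0, 0, 0, 1, 0)

/-- The symmetry with the code `g` takes the integral vector `u` to `w`. -/
def SymCode.Maps (g : SymCode) (u w : Meas → ℤ) : Prop :=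
  ∀ m, w (g.perm m) = sgnZ (g.sign m) * u m

instance (g : SymCode) (u w : Meas → ℤ) : Decidable (g.Maps u w) := by
  unfold SymCode.Maps; infer_instance

/-- The scalar product of integral vectors. -/
def dotZ (u v : Meas → ℤ) : ℤ := ∑ m, u m * v m

/-- The numerical criterion for vertices to be neighbors: distinct vertices have a scalar product
between `-3` and `3`, and the neighbors are those with scalar product `2` or `3`. -/
def Adj (u v : Meas → ℤ) : Prop := u ≠ v ∧ (dotZ u v = 2 ∨ dotZ u v = 3)

instance (u v : Meas → ℤ) : Decidable (Adj u v) := by unfold Adj; infer_instance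

theorem castV_dotProduct (u v : Meas → ℤ) : castV u ⬝ᵥ castV v = (dotZ u v : ℝ) := by
  simp [dotProduct, castV, dotZ]

section Orbits

variable {γ : Corr ≃ₗ[ℝ] Corr} {u u' v v' : Meas → ℤ} {a b : Label1 ⊕ Label2}

theorem SymCode.Maps.toSym_castV {g : SymCode} (h : g.Maps u v) : g.toSym (castV u) = castV v := by
  ext m
  obtain ⟨m, rfl⟩ := g.perm.surjective m
  rw [SymCode.toSym, signedPerm_apply, castV, castV, h, Int.cast_mul, cast_sgnZ]

theorem dotZ_eq_of_map (hγ : γ ∈ symGroup) (hu : γ (castV u) = castV u')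
    (hv : γ (castV v) = castV v') : dotZ u' v' = dotZ u v := by
  have h := hγ.2 (castV u) (castV v)
  rw [hu, hv, castV_dotProduct, castV_dotProduct] at h
  exact_mod_cast h

theorem adj_iff_of_map (hγ : γ ∈ symGroup) (hu : γ (castV u) = castV u')
    (hv : γ (castV v) = castV v') : Adj u' v' ↔ Adj u v := by
  rw [Adj, Adj, dotZ_eq_of_map hγ hu hv, ← castV_injective.ne_iff, ← hu, ← hv,
    γ.injective.ne_iff, castV_injective.ne_iff]

theorem exists_map_castV_vtx (hγ : γ ∈ symGroup) (b : Label1 ⊕ Label2) :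
    ∃ a, γ (castV (vtx a)) = castV (vtx b) := by
  have hext := (map_mem_extremePoints (inv_mem hγ)).2 (castV_vtx_mem_extremePoints b)
  obtain ⟨a, ha⟩ := exists_eq_castV_vtx_of_mem_extremePoints hext
  exact ⟨a, by rw [← ha, apply_inv_apply]⟩

theorem exists_maps_q0 : ∀ a, ∃ g : SymCode, g.Maps (vtx q0) (vtx (Sum.inl a)) := by
  decide +kernel

theorem exists_maps_p0 : ∀ a, ∃ g : SymCode, g.Maps (vtx p0) (vtx (Sum.inr a)) := by
  decide +kernel

theorem exists_toSym_eq (a b : Label1 ⊕ Label2) : ∃ (g : SymCode) (a₀ b₀ : Label1 ⊕ Label2),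
    (a₀ = q0 ∨ a₀ = p0) ∧ g.toSym (castV (vtx a₀)) = castV (vtx a) ∧
      g.toSym (castV (vtx b₀)) = castV (vtx b) := by
  obtain ⟨g, a₀, ha₀, hg⟩ : ∃ (g : SymCode) (a₀ : Label1 ⊕ Label2),
      (a₀ = q0 ∨ a₀ = p0) ∧ g.Maps (vtx a₀) (vtx a) := by
    rcases a with a | a
    · exact (exists_maps_q0 a).imp fun g hg => ⟨q0, Or.inl rfl, hg⟩
    · exact (exists_maps_p0 a).imp fun g hg => ⟨p0, Or.inr rfl, hg⟩
  obtain ⟨b₀, hb₀⟩ := exists_map_castV_vtx g.toSym_mem_implGroup.1 b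
  exact ⟨g, a₀, b₀, ha₀, hg.toSym_castV, hb₀⟩

end Orbits

/-! ### The edges of the odd polytope -/

section Edges

variable {a b : Label1 ⊕ Label2}

set_option synthInstance.maxSize 2000 in
theorem eq_or_eq_of_adj_q0 : ∀ a, Adj (vtx q0) (vtx a) → ∀ c,
    (∀ C s, ∑ k, s k = beta1 C → rowZ C s (vtx q0) = -1 → rowZ C s (vtx a) = -1 →
      rowZ C s (vtx c) = -1) → vtx c = vtx q0 ∨ vtx c = vtx a := by
  decide +kernel

set_option synthInstance.maxSize 2000 in
theorem eq_or_eq_of_adj_p0 : ∀ a, Adj (vtx p0) (vtx a) → ∀ c,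
    (∀ C s, ∑ k, s k = beta1 C → rowZ C s (vtx p0) = -1 → rowZ C s (vtx a) = -1 →
      rowZ C s (vtx c) = -1) → vtx c = vtx p0 ∨ vtx c = vtx a := by
  decide +kernel

theorem isExposed_segment_of_adj (h : Adj (vtx a) (vtx b)) :
    IsExposed ℝ (corrPolytope beta1) (segment ℝ (castV (vtx a)) (castV (vtx b))) := by
  obtain ⟨g, a₀, b₀, ha₀, hga, hgb⟩ := exists_toSym_eq a b
  have hg := g.toSym_mem_implGroup.1
  rw [adj_iff_of_map hg hga hgb] at h
  rw [← hga, ← hgb]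
  refine isExposed_segment_map hg (isExposed_segment_of_extremePoints_tight
    isCompact_corrPolytope (castV_vtx_mem_corrPolytope a₀)
    (castV_vtx_mem_corrPolytope b₀) fun x hx htight => ?_)
  obtain ⟨c, rfl⟩ := exists_eq_castV_vtx_of_mem_extremePoints hx
  have htightZ (C s) (hs : ∑ k, s k = beta1 C) (ha : rowZ C s (vtx a₀) = -1)
      (hb : rowZ C s (vtx b₀) = -1) : rowZ C s (vtx c) = -1 := by
    have hc := htight ⟨(C, s), hs⟩ (by simp [row_castV, ha]) (by simp [row_castV, hb])
    rw [row_castV] at hc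
    exact_mod_cast hc
  rw [castV_injective.eq_iff, castV_injective.eq_iff]
  rcases ha₀ with rfl | rfl
  · exact eq_or_eq_of_adj_q0 b₀ h c htightZ
  · exact eq_or_eq_of_adj_p0 b₀ h c htightZ

set_option synthInstance.maxSize 2000 in
theorem exists_neg_one_le_rowZ_q0 : ∀ a, vtx a ≠ vtx q0 → ¬ Adj (vtx q0) (vtx a) →
    ∃ c, vtx c ≠ vtx q0 ∧ vtx c ≠ vtx a ∧
      ∀ C s, ∑ k, s k = beta1 C → -1 ≤ rowZ C s (vtx q0 + vtx a - vtx c) := by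
  decide +kernel

set_option synthInstance.maxSize 2000 in
theorem exists_neg_one_le_rowZ_p0 : ∀ a, vtx a ≠ vtx p0 → ¬ Adj (vtx p0) (vtx a) →
    ∃ c, vtx c ≠ vtx p0 ∧ vtx c ≠ vtx a ∧
      ∀ C s, ∑ k, s k = beta1 C → -1 ≤ rowZ C s (vtx p0 + vtx a - vtx c) := by
  decide +kernel

theorem exists_add_sub_mem_corrPolytope_of_not_adj {a₀ : Label1 ⊕ Label2}
    (ha₀ : a₀ = q0 ∨ a₀ = p0) (hne : vtx a ≠ vtx a₀) (h : ¬ Adj (vtx a₀) (vtx a)) :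
    ∃ c, vtx c ≠ vtx a₀ ∧ vtx c ≠ vtx a ∧
      castV (vtx a₀ + vtx a - vtx c) ∈ corrPolytope beta1 := by
  rcases ha₀ with rfl | rfl
  · obtain ⟨c, hca₀, hca, hc⟩ := exists_neg_one_le_rowZ_q0 a hne h
    exact ⟨c, hca₀, hca, castV_mem_corrPolytope hc⟩
  · obtain ⟨c, hca₀, hca, hc⟩ := exists_neg_one_le_rowZ_p0 a hne h
    exact ⟨c, hca₀, hca, castV_mem_corrPolytope hc⟩

theorem adj_of_isExtreme_segment (hne : a ≠ b)
    (h : IsExtreme ℝ (corrPolytope beta1) (segment ℝ (castV (vtx a)) (castV (vtx b)))) :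
    Adj (vtx a) (vtx b) := by
  obtain ⟨g, a₀, b₀, ha₀, hga, hgb⟩ := exists_toSym_eq a b
  have hg := g.toSym_mem_implGroup.1
  have hne₀ : vtx b₀ ≠ vtx a₀ := fun heq => hne <| vtx_injective <| castV_injective <| by
    rw [← hga, ← hgb, heq]
  replace h : IsExtreme ℝ (corrPolytope beta1) (segment ℝ (castV (vtx a₀)) (castV (vtx b₀))) := by
    rw [← isExtreme_image_iff g.toSym.toLinearMap.toAffineMap g.toSym.injective, image_segment]
    have himage : ⇑g.toSym.toLinearMap.toAffineMap '' corrPolytope beta1 = corrPolytope beta1 :=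
      image_corrPolytope hg
    rw [himage]
    exact hga.symm ▸ hgb.symm ▸ h
  rw [adj_iff_of_map hg hga hgb]
  by_contra hadj
  obtain ⟨c, hca, hcb, hmem⟩ := exists_add_sub_mem_corrPolytope_of_not_adj ha₀ hne₀ hadj
  have hsum : castV (vtx c) + castV (vtx a₀ + vtx b₀ - vtx c) =
      castV (vtx a₀) + castV (vtx b₀) := by
    ext m; simp [castV]
  rcases eq_or_eq_of_add_eq_add_of_isExtreme_segment h (castV_vtx_mem_extremePoints c) hmem hsum
    with heq | heq
  · exact hca (castV_injective heq)
  · exact hcb (castV_injective heq)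

theorem abs_sub_le_one_of_adj_base : ∀ a,
    (Adj (vtx q0) (vtx a) → ∀ m, |vtx a m - vtx q0 m| ≤ 1) ∧
      (Adj (vtx p0) (vtx a) → ∀ m, |vtx a m - vtx p0 m| ≤ 1) := by
  decide +kernel

theorem abs_sub_le_one_of_adj (h : Adj (vtx a) (vtx b)) (m : Meas) :
    |vtx b m - vtx a m| ≤ 1 := by
  obtain ⟨g, a₀, b₀, ha₀, hga, hgb⟩ := exists_toSym_eq a b
  rw [adj_iff_of_map g.toSym_mem_implGroup.1 hga hgb] at h
  have hbase (m) : |vtx b₀ m - vtx a₀ m| ≤ 1 := by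
    rcases ha₀ with rfl | rfl
    · exact (abs_sub_le_one_of_adj_base b₀).1 h m
    · exact (abs_sub_le_one_of_adj_base b₀).2 h m
  obtain ⟨n, rfl⟩ := g.perm.surjective m
  have hdiff : ((vtx b (g.perm n) - vtx a (g.perm n) : ℤ) : ℝ) =
      sgn (g.sign n) * ((vtx b₀ n - vtx a₀ n : ℤ) : ℝ) := by
    have ha := congrFun hga (g.perm n)
    have hb := congrFun hgb (g.perm n)
    rw [SymCode.toSym, signedPerm_apply] at ha hb
    simp only [castV] at ha hb
    push_cast
    linear_combination ha - hb
  have hn : |((vtx b₀ n - vtx a₀ n : ℤ) : ℝ)| ≤ 1 := by exact_mod_cast hbase n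
  have habs := congrArg abs hdiff
  rw [abs_mul, abs_sgn, one_mul] at habs
  exact_mod_cast habs.trans_le hn

end Edges

/-! ### Vertices and their types -/

section Vertices

variable {a b : Label1 ⊕ Label2}

/-- The vertex of the odd polytope with the label `a`. -/
def vertexOf (a : Label1 ⊕ Label2) : Vertex :=
  ⟨distOf beta1 (castV (vtx a)),
    (extremePoints_MP beta1).superset ⟨_, castV_vtx_mem_extremePoints a, rfl⟩⟩

theorem expect_vertexOf (a : Label1 ⊕ Label2) : expect (vertexOf a).1 = castV (vtx a) :=
  expect_distOf _ _

theorem vertexOf_injective : Function.Injective vertexOf := fun a b h =>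
  vtx_injective <| castV_injective <| by rw [← expect_vertexOf, h, expect_vertexOf]

theorem vertexOf_surjective : Function.Surjective vertexOf := fun p => by
  obtain ⟨e, he, hp⟩ := (extremePoints_MP beta1).subset p.2
  obtain ⟨a, rfl⟩ := exists_eq_castV_vtx_of_mem_extremePoints he
  exact ⟨a, Subtype.ext hp⟩

/-- The support of an integral vector. -/
def suppSet (u : Meas → ℤ) : Finset Meas := {m | u m ≠ 0}

theorem mem_suppSet {u : Meas → ℤ} {m : Meas} : m ∈ suppSet u ↔ u m ≠ 0 := by simp [suppSet]

theorem suppSet_vtx_inl (a : Label1) : suppSet (vtx (Sum.inl a)) = transversal a.1 := by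
  ext m; rw [mem_suppSet, vtx_inl_ne_zero_iff]

theorem suppSet_vtx_inr (a : Label2) : suppSet (vtx (Sum.inr a)) = cross a.1 a.2.1 := by
  ext m; rw [mem_suppSet, vtx_inr_ne_zero_iff]

theorem hasMarginals_distOf_iff {e : Corr} {Ω : Finset Meas} {s : Assign Ω} :
    HasMarginals (distOf beta1 e) Ω s ↔
      (∀ m (h : m ∈ Ω), e m = sgn (s ⟨m, h⟩)) ∧ ∀ m ∉ Ω, e m = 0 := by
  simp only [HasMarginals, prob_distOf, sgn_zero, one_mul]
  constructor
  · refine fun h => ⟨fun m hm => ?_, fun m hm => ?_⟩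
    · have := (h (Sum.inl m.1) ⟨m, by simp [ctx]⟩).1 hm
      linarith
    · have := (h (Sum.inl m.1) ⟨m, by simp [ctx]⟩).2 hm
      linarith
  · rintro ⟨hmem, hnotMem⟩ C ⟨m, hm⟩
    exact ⟨fun h => by rw [hmem m h], fun h => by rw [hnotMem m h, add_zero]⟩

theorem HasMarginals.suppSet_eq {Ω : Finset Meas} {s : Assign Ω}
    (h : HasMarginals (vertexOf a).1 Ω s) : suppSet (vtx a) = Ω := by
  obtain ⟨hmem, hnotMem⟩ := hasMarginals_distOf_iff.1 h
  ext m
  rw [mem_suppSet, ← Int.cast_ne_zero (α := ℝ)]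
  change castV (vtx a) m ≠ 0 ↔ _
  by_cases hm : m ∈ Ω
  · simp only [hmem m hm, hm, ← abs_ne_zero (a := sgn _), abs_sgn, ne_eq, one_ne_zero,
      not_false_eq_true]
  · simp only [hnotMem m hm, hm, ne_eq, not_true_eq_false]

theorem sum_restrict {Ω : Finset Meas} (s : Assign Ω) {C : Ctx} (hC : ctx C ⊆ Ω) :
    ∑ m, restrict hC s m = ∑ k, s ⟨ctxMeas C k, hC (ctxMeas_mem_ctx C k)⟩ :=
  ((ctxEquiv C).sum_comp _).symm

theorem exists_isOutcome_hasMarginals (a : Label1 ⊕ Label2) :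
    ∃ s : Assign (suppSet (vtx a)), IsOutcome beta1 _ s ∧
      HasMarginals (vertexOf a).1 _ s := by
  choose s hs using fun m : {m // m ∈ suppSet (vtx a)} =>
    exists_castV_vtx_eq_sgn a (mem_suppSet.1 m.2)
  refine ⟨s, fun C hC => ?_, hasMarginals_distOf_iff.2 ⟨fun m hm => hs ⟨m, hm⟩, fun m hm => ?_⟩⟩
  · rw [sum_restrict]
    exact sum_eq_of_apply_eq_sgn (castV_vtx_mem_corrPolytope a) fun k => hs ⟨ctxMeas C k, _⟩
  · rw [mem_suppSet, not_not] at hm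
    rw [castV, hm, Int.cast_zero]

theorem not_isCNC_univ : ¬ IsCNC beta1 Finset.univ := by
  rintro ⟨-, s, hs⟩
  refine not_forall_sum_eq_beta1 (fun m => s ⟨m, Finset.mem_univ m⟩) fun C => ?_
  rw [← hs C (Finset.subset_univ _), sum_restrict]

theorem eq_or_eq_univ_of_transversal_subset : ∀ σ Ω, transversal σ ⊆ Ω → IsClosedSet Ω →
    Ω = transversal σ ∨ Ω = Finset.univ := by
  decide +kernel

theorem eq_or_eq_univ_of_cross_subset : ∀ i j Ω, cross i j ⊆ Ω → IsClosedSet Ω →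
    Ω = cross i j ∨ Ω = Finset.univ := by
  decide +kernel

theorem isClosedSet_transversal : ∀ σ, IsClosedSet (transversal σ) := by decide +kernel

theorem isClosedSet_cross : ∀ i j, IsClosedSet (cross i j) := by decide +kernel

theorem isClosedSet_suppSet (a : Label1 ⊕ Label2) : IsClosedSet (suppSet (vtx a)) := by
  rcases a with a | a
  · exact suppSet_vtx_inl a ▸ isClosedSet_transversal a.1
  · exact suppSet_vtx_inr a ▸ isClosedSet_cross a.1 a.2.1

theorem eq_or_eq_univ_of_suppSet_subset {Ω : Finset Meas} (hsub : suppSet (vtx a) ⊆ Ω)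
    (hΩ : IsClosedSet Ω) : Ω = suppSet (vtx a) ∨ Ω = Finset.univ := by
  rcases a with a | a
  · rw [suppSet_vtx_inl] at hsub ⊢
    exact eq_or_eq_univ_of_transversal_subset _ _ hsub hΩ
  · rw [suppSet_vtx_inr] at hsub ⊢
    exact eq_or_eq_univ_of_cross_subset _ _ _ hsub hΩ

theorem maximal_isCNC_suppSet (a : Label1 ⊕ Label2) :
    Maximal (IsCNC beta1) (suppSet (vtx a)) := by
  obtain ⟨s, hs, -⟩ := exists_isOutcome_hasMarginals a
  refine ⟨⟨isClosedSet_suppSet a, s, hs⟩, fun Ω hΩ hsub => ?_⟩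
  rcases eq_or_eq_univ_of_suppSet_subset hsub hΩ.1 with h | h
  · exact h.le
  · exact absurd (h ▸ hΩ) not_isCNC_univ

theorem card_transversal : ∀ σ, (transversal σ).card = 3 := by decide +kernel

theorem card_cross : ∀ i j, (cross i j).card = 5 := by decide +kernel

set_option synthInstance.maxSize 400 in
theorem not_exists_mem_ctx_of_mem_transversal : ∀ σ, ∀ m ∈ transversal σ,
    ∀ n ∈ transversal σ, m ≠ n → ¬ ∃ C, m ∈ ctx C ∧ n ∈ ctx C := by
  decide +kernel

theorem card_ctx_union : ∀ C C' : Ctx, (ctx C ∩ ctx C').card = 1 →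
    (ctx C ∪ ctx C').card = 5 := by
  decide +kernel

theorem cross_eq_ctx_union : ∀ i j, (ctx (Sum.inl i) ∩ ctx (Sum.inr j)).card = 1 ∧
    cross i j = ctx (Sum.inl i) ∪ ctx (Sum.inr j) := by
  decide +kernel

theorem type1_eq_range : Type1 = Set.range (vertexOf ∘ Sum.inl) := by
  ext p
  constructor
  · rintro ⟨Ω, s, ⟨-, hcard, -⟩, -, hmarg⟩
    obtain ⟨a | a, rfl⟩ := vertexOf_surjective p
    · exact ⟨a, rfl⟩
    · rw [← hmarg.suppSet_eq, suppSet_vtx_inr, card_cross] at hcard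
      contradiction
  · rintro ⟨a, rfl⟩
    obtain ⟨s, hs, hmarg⟩ := exists_isOutcome_hasMarginals (Sum.inl a)
    refine ⟨_, s, ⟨maximal_isCNC_suppSet _, ?_⟩, hs, hmarg⟩
    rw [suppSet_vtx_inl]
    exact ⟨card_transversal a.1, not_exists_mem_ctx_of_mem_transversal a.1⟩

theorem type2_eq_range : Type2 = Set.range (vertexOf ∘ Sum.inr) := by
  ext p
  constructor
  · rintro ⟨Ω, s, ⟨-, C, C', -, hinter, rfl⟩, -, hmarg⟩
    obtain ⟨a | a, rfl⟩ := vertexOf_surjective p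
    · have hcard := card_ctx_union C C' hinter
      rw [← hmarg.suppSet_eq, suppSet_vtx_inl, card_transversal] at hcard
      contradiction
    · exact ⟨a, rfl⟩
  · rintro ⟨a, rfl⟩
    obtain ⟨s, hs, hmarg⟩ := exists_isOutcome_hasMarginals (Sum.inr a)
    refine ⟨_, s, ⟨maximal_isCNC_suppSet _, Sum.inl a.1, Sum.inr a.2.1, Sum.inl_ne_inr, ?_⟩, hs,
      hmarg⟩
    rw [suppSet_vtx_inr]
    exact cross_eq_ctx_union a.1 a.2.1

theorem card_vertex : Nat.card Vertex = 120 := by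
  rw [← Nat.card_congr (Equiv.ofBijective _ ⟨vertexOf_injective, vertexOf_surjective⟩),
    Nat.card_eq_fintype_card]
  decide +kernel

theorem ncard_type1 : Type1.ncard = 48 := by
  rw [type1_eq_range, Set.ncard_range_of_injective (vertexOf_injective.comp Sum.inl_injective),
    Nat.card_eq_fintype_card]
  decide +kernel

theorem ncard_type2 : Type2.ncard = 72 := by
  rw [type2_eq_range, Set.ncard_range_of_injective (vertexOf_injective.comp Sum.inr_injective),
    Nat.card_eq_fintype_card]
  decide +kernel

theorem disjoint_type1_type2 : Disjoint Type1 Type2 := by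
  rw [type1_eq_range, type2_eq_range, Set.range_comp, Set.range_comp,
    Set.disjoint_image_iff vertexOf_injective]
  exact Set.isCompl_range_inl_range_inr.disjoint

theorem type1_union_type2 : Type1 ∪ Type2 = Set.univ := by
  rw [type1_eq_range, type2_eq_range, Set.range_comp, Set.range_comp, ← Set.image_union,
    Set.range_inl_union_range_inr, Set.image_univ, vertexOf_surjective.range_eq]

theorem mem_N_iff : vertexOf b ∈ N (vertexOf a) ↔ Adj (vtx a) (vtx b) := by
  constructor
  · rintro ⟨hne, h⟩
    exact adj_of_isExtreme_segment (fun hab => hne (congrArg vertexOf hab))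
      (isExtreme_corrPolytope_segment h)
  · intro h
    exact ⟨fun hab => h.1 (congrArg vtx (vertexOf_injective hab)),
      isExposed_MP_segment (isExposed_segment_of_adj h)⟩

end Vertices

/-! ### Loops along the edges -/

section Loops

variable {u v d : Meas → ℤ}

theorem completeBipartiteGraph_adj_inl_inr (i j : Fin 3) :
    (completeBipartiteGraph (Fin 3) (Fin 3)).Adj (Sum.inl i) (Sum.inr j) := by simp

theorem isLoop_square {i i' j j' : Fin 3} (hi : i ≠ i') (hj : j ≠ j') {L : Finset Meas}
    (hL : ∀ m, m ∈ L ↔ m = (i, j) ∨ m = (i', j) ∨ m = (i', j') ∨ m = (i, j')) : IsLoop L := by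
  let w : (completeBipartiteGraph (Fin 3) (Fin 3)).Walk (Sum.inl i) (Sum.inl i) :=
    .cons (completeBipartiteGraph_adj_inl_inr i j)
      (.cons (completeBipartiteGraph_adj_inl_inr i' j).symm
        (.cons (completeBipartiteGraph_adj_inl_inr i' j')
          (.cons (completeBipartiteGraph_adj_inl_inr i j').symm .nil)))
  refine ⟨_, w, ?_, fun m => ?_⟩
  · rw [SimpleGraph.Walk.isCycle_def, SimpleGraph.Walk.isTrail_def]
    simp [w, hi, hj, hi.symm]
  · rw [hL]
    simp [w, Prod.ext_iff]

theorem isLoop_hexagon {a b c : Fin 3} (hab : a ≠ b) (hac : a ≠ c) (hbc : b ≠ c)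
    {L : Finset Meas} (hL : ∀ m, m ∈ L ↔ m = (0, a) ∨ m = (1, a) ∨ m = (1, b) ∨ m = (2, b) ∨
      m = (2, c) ∨ m = (0, c)) : IsLoop L := by
  let w : (completeBipartiteGraph (Fin 3) (Fin 3)).Walk (Sum.inl 0) (Sum.inl 0) :=
    .cons (completeBipartiteGraph_adj_inl_inr 0 a)
      (.cons (completeBipartiteGraph_adj_inl_inr 1 a).symm
        (.cons (completeBipartiteGraph_adj_inl_inr 1 b)
          (.cons (completeBipartiteGraph_adj_inl_inr 2 b).symm
            (.cons (completeBipartiteGraph_adj_inl_inr 2 c)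
              (.cons (completeBipartiteGraph_adj_inl_inr 0 c).symm .nil)))))
  refine ⟨_, w, ?_, fun m => ?_⟩
  · rw [SimpleGraph.Walk.isCycle_def, SimpleGraph.Walk.isTrail_def]
    simp [w, hab, hac, hbc]
  · rw [hL]
    simp [w, Prod.ext_iff]

set_option synthInstance.maxSize 2000 in
theorem eq_square_or_eq_hexagon_of_sum_eq_zero : ∀ x : Meas → ZMod 2,
    (∀ C, ∑ k, x (ctxMeas C k) = 0) → x ≠ 0 →
      (∃ i i' j j', i ≠ i' ∧ j ≠ j' ∧ ∀ m, x m = 1 ↔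
        m = (i, j) ∨ m = (i', j) ∨ m = (i', j') ∨ m = (i, j')) ∨
      ∃ a b c, a ≠ b ∧ a ≠ c ∧ b ≠ c ∧ ∀ m, x m = 1 ↔ m = (0, a) ∨ m = (1, a) ∨ m = (1, b) ∨
        m = (2, b) ∨ m = (2, c) ∨ m = (0, c) := by
  decide +kernel

/-- Nonzero vectors with entries `0` and `±1` whose sums over the contexts are even; these are the
vectors `φ` of the signed loops. -/
structure IsLoopVec (d : Meas → ℤ) : Prop where
  abs_le_one (m : Meas) : |d m| ≤ 1
  ne_zero : d ≠ 0
  sum_eq_zero (C : Ctx) : ∑ k, (d (ctxMeas C k) : ZMod 2) = 0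

theorem IsLoopVec.eq_zero_or_eq_one_or_eq_neg_one (hd : IsLoopVec d) (m : Meas) :
    d m = 0 ∨ d m = 1 ∨ d m = -1 := by
  have := abs_le.1 (hd.abs_le_one m)
  omega

theorem IsLoopVec.intCast_eq_one_iff (hd : IsLoopVec d) (m : Meas) :
    (d m : ZMod 2) = 1 ↔ d m ≠ 0 := by
  rcases hd.eq_zero_or_eq_one_or_eq_neg_one m with h | h | h <;> simp [h]

theorem IsLoopVec.isLoop (hd : IsLoopVec d) : IsLoop (suppSet d) := by
  have hsupp (m) : m ∈ suppSet d ↔ (d m : ZMod 2) = 1 := by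
    rw [mem_suppSet, hd.intCast_eq_one_iff]
  have hne : (fun m => (d m : ZMod 2)) ≠ 0 := fun h => hd.ne_zero <| funext fun m => by
    by_contra hm
    exact one_ne_zero (((hd.intCast_eq_one_iff m).2 hm).symm.trans (congrFun h m))
  rcases eq_square_or_eq_hexagon_of_sum_eq_zero _ hd.sum_eq_zero hne with
    ⟨i, i', j, j', hi, hj, h⟩ | ⟨a, b, c, hab, hac, hbc, h⟩
  · exact isLoop_square hi hj fun m => by rw [hsupp, h]
  · exact isLoop_hexagon hab hac hbc fun m => by rw [hsupp, h]

/-- The signs of a vector with entries `0` and `±1`, on its support. -/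
def signUnit (d : Meas → ℤ) (m : {m : Meas // m ∈ suppSet d}) : ℤˣ := if d m = 1 then 1 else -1

theorem IsLoopVec.half_smul_loopDir (hd : IsLoopVec d) :
    (1 / 2 : ℝ) • loopDir (suppSet d) (signUnit d) = distOfLin beta1 (castV d) := by
  have hval (m) : (if h : m ∈ suppSet d then (((signUnit d ⟨m, h⟩ : ℤˣ) : ℤ) : ℝ) else 0) =
      castV d m := by
    rcases hd.eq_zero_or_eq_one_or_eq_neg_one m with h | h | h <;>
      simp [mem_suppSet, signUnit, castV, h]
  ext C s
  simp only [Pi.smul_apply, smul_eq_mul, loopDir, hval, distOfLin, LinearMap.coe_mk,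
    AddHom.coe_mk]
  split_ifs
  · ring
  · exact mul_zero _

theorem distOf_add_half_smul_loopDir (h : IsLoopVec (v - u)) :
    distOf beta1 (castV u) + (1 / 2 : ℝ) • loopDir (suppSet (v - u)) (signUnit (v - u)) =
      distOf beta1 (castV v) := by
  rw [h.half_smul_loopDir, ← distOf_add]
  congr 1
  ext m
  simp [castV]

theorem segment_eq_image_of_add_half_smul {E : Type*} [AddCommGroup E] [Module ℝ E] {x y d : E}
    (h : x + (1 / 2 : ℝ) • d = y) :
    segment ℝ x y = (fun α : ℝ => x + α • d) '' Set.Icc 0 (1 / 2) := by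
  rw [segment_eq_image', ← h]
  ext z
  constructor
  · rintro ⟨θ, ⟨h0, h1⟩, rfl⟩
    exact ⟨θ / 2, ⟨by linarith, by linarith⟩, by module⟩
  · rintro ⟨α, ⟨h0, h1⟩, rfl⟩
    exact ⟨2 * α, ⟨by linarith, by linarith⟩, by module⟩

theorem sum_vtx_eq_one : ∀ a C, ∑ k, (vtx a (ctxMeas C k) : ZMod 2) = 1 := by
  decide +kernel

theorem isLoopVec_vtx_sub {a b : Label1 ⊕ Label2} (hne : vtx a ≠ vtx b)
    (h : ∀ m, |vtx b m - vtx a m| ≤ 1) : IsLoopVec (vtx b - vtx a) where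
  abs_le_one := h
  ne_zero := sub_ne_zero.2 hne.symm
  sum_eq_zero C := by
    simp only [Pi.sub_apply, Int.cast_sub, Finset.sum_sub_distrib, sum_vtx_eq_one, sub_self]

theorem exists_loop_of_mem_N {q₁ q₂ : Vertex} (h : q₂ ∈ N q₁) :
    ∃ (L : Finset Meas) (φ : {m : Meas // m ∈ L} → ℤˣ), IsLoop L ∧
      segment ℝ (q₁ : Dist) (q₂ : Dist) =
        (fun α : ℝ => (q₁ : Dist) + α • loopDir L φ) '' Set.Icc 0 (1 / 2) ∧
      (q₁ : Dist) + (1 / 2 : ℝ) • loopDir L φ = (q₂ : Dist) := by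
  obtain ⟨a, rfl⟩ := vertexOf_surjective q₁
  obtain ⟨b, rfl⟩ := vertexOf_surjective q₂
  have hadj := mem_N_iff.1 h
  have hloop := isLoopVec_vtx_sub hadj.1 (abs_sub_le_one_of_adj hadj)
  have hadd := distOf_add_half_smul_loopDir hloop
  exact ⟨_, _, hloop.isLoop, segment_eq_image_of_add_half_smul hadd, hadd⟩

end Loops

/-! ### Neighbors and scalar products -/

section Levels

variable {γ : Corr ≃ₗ[ℝ] Corr} {a b c : Label1 ⊕ Label2} {n k : ℤ}

/-- The labels of the vertices of squared norm `n` that have the scalar product `k` with the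
vertex labelled `a`. -/
def level (a : Label1 ⊕ Label2) (n k : ℤ) : Finset (Label1 ⊕ Label2) :=
  {c | dotZ (vtx c) (vtx c) = n ∧ dotZ (vtx a) (vtx c) = k}

theorem mem_level : c ∈ level a n k ↔
    dotZ (vtx c) (vtx c) = n ∧ dotZ (vtx a) (vtx c) = k := by
  simp [level]

theorem card_level_le_of_map (hγ : γ ∈ symGroup) (h : γ (castV (vtx a)) = castV (vtx b)) :
    (level b n k).card ≤ (level a n k).card := by
  choose f hf using exists_map_castV_vtx hγ
  refine Finset.card_le_card_of_injOn f (fun c hc => ?_) fun c _ c' _ hcc' => ?_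
  · rw [Finset.mem_coe, mem_level] at hc ⊢
    rwa [← dotZ_eq_of_map hγ (hf c) (hf c), ← dotZ_eq_of_map hγ h (hf c)]
  · exact vtx_injective (castV_injective (by rw [← hf, hcc', hf]))

theorem card_level_eq_of_map (hγ : γ ∈ symGroup) (h : γ (castV (vtx a)) = castV (vtx b)) :
    (level b n k).card = (level a n k).card :=
  (card_level_le_of_map hγ h).antisymm
    (card_level_le_of_map (inv_mem hγ) (by rw [← h, inv_apply_apply]))

theorem card_level_q0 : (level q0 5 2).card = 12 := by decide +kernel

theorem card_level_p0 : (level p0 3 2).card = 8 ∧ (level p0 5 2).card = 8 ∧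
    (level p0 5 3).card = 8 := by
  decide +kernel

theorem card_level_inl (a : Label1) : (level (Sum.inl a) 5 2).card = 12 := by
  obtain ⟨g, hg⟩ := exists_maps_q0 a
  rw [card_level_eq_of_map g.toSym_mem_implGroup.1 hg.toSym_castV, card_level_q0]

theorem card_level_inr (a : Label2) : (level (Sum.inr a) 3 2).card = 8 ∧
    (level (Sum.inr a) 5 2).card = 8 ∧ (level (Sum.inr a) 5 3).card = 8 := by
  obtain ⟨g, hg⟩ := exists_maps_p0 a
  simp only [card_level_eq_of_map g.toSym_mem_implGroup.1 hg.toSym_castV, card_level_p0,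
    and_self]

theorem adj_q0_iff : ∀ c, Adj (vtx q0) (vtx c) ↔
    dotZ (vtx c) (vtx c) = 5 ∧ dotZ (vtx q0) (vtx c) = 2 := by
  decide +kernel

theorem adj_p0_iff : ∀ c, Adj (vtx p0) (vtx c) ↔
    dotZ (vtx c) (vtx c) = 3 ∧ dotZ (vtx p0) (vtx c) = 2 ∨
      dotZ (vtx c) (vtx c) = 5 ∧ (dotZ (vtx p0) (vtx c) = 2 ∨ dotZ (vtx p0) (vtx c) = 3) := by
  decide +kernel

theorem adj_inl_iff {a : Label1} : Adj (vtx (Sum.inl a)) (vtx c) ↔ c ∈ level (Sum.inl a) 5 2 := by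
  obtain ⟨g, hg⟩ := exists_maps_q0 a
  have hsym := g.toSym_mem_implGroup.1
  obtain ⟨c₀, hc₀⟩ := exists_map_castV_vtx hsym c
  rw [mem_level, adj_iff_of_map hsym hg.toSym_castV hc₀,
    dotZ_eq_of_map hsym hc₀ hc₀, dotZ_eq_of_map hsym hg.toSym_castV hc₀, adj_q0_iff]

theorem adj_inr_iff {a : Label2} : Adj (vtx (Sum.inr a)) (vtx c) ↔
    c ∈ level (Sum.inr a) 3 2 ∨ c ∈ level (Sum.inr a) 5 2 ∪ level (Sum.inr a) 5 3 := by
  obtain ⟨g, hg⟩ := exists_maps_p0 a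
  have hsym := g.toSym_mem_implGroup.1
  obtain ⟨c₀, hc₀⟩ := exists_map_castV_vtx hsym c
  rw [Finset.mem_union, mem_level, mem_level, mem_level,
    adj_iff_of_map hsym hg.toSym_castV hc₀, dotZ_eq_of_map hsym hc₀ hc₀,
    dotZ_eq_of_map hsym hg.toSym_castV hc₀, adj_p0_iff, and_or_left]

theorem adj_of_mem_level (h : Adj (vtx a) (vtx b))
    (hc : c ∈ level a (dotZ (vtx b) (vtx b)) (dotZ (vtx a) (vtx b))) :
    Adj (vtx a) (vtx c) := by
  rcases a with a | a
  · simp only [adj_inl_iff, mem_level] at h hc ⊢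
    rwa [hc.1, hc.2]
  · simp only [adj_inr_iff, Finset.mem_union, mem_level] at h hc ⊢
    rwa [hc.1, hc.2]

end Levels

/-! ### Operators and stabilizer orbits -/

section StabOrbit

variable {a b : Label1 ⊕ Label2}

theorem injOn_toOp : Set.InjOn toOp (MP beta1) := fun p hp q hq h => by
  rw [toOp_eq, toOp_eq] at h
  rw [← distOf_expect hp, ← distOf_expect hq, opOf_injective h]

theorem image_toOp : toOp '' MP beta1 = opOf '' corrPolytope beta1 := by
  rw [MP_eq_image, Set.image_image]
  exact Set.image_congr fun e _ => by rw [toOp_eq, expect_distOf]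

theorem G1_image_toOp {g : Op2 ≃ₐ[ℂ] Op2} (hg : g ∈ G1) :
    g '' (toOp '' MP beta1) = toOp '' MP beta1 := by
  obtain ⟨γ, hγ, h⟩ := exists_implements_of_mem_G1 hg
  rw [image_toOp, Set.image_image]
  conv_rhs => rw [← image_corrPolytope hγ, Set.image_image]
  exact Set.image_congr fun e _ => h e

theorem toOp_vertexOf (a : Label1 ⊕ Label2) : toOp (vertexOf a) = opOf (castV (vtx a)) := by
  rw [toOp_eq, expect_vertexOf]

theorem toOp_vertexOf_injective : Function.Injective fun a => toOp (vertexOf a) := fun a b h =>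
  vtx_injective <| castV_injective <| opOf_injective <| by
    rw [← toOp_vertexOf, ← toOp_vertexOf]; exact h

/-- The operators of the vertices with labels in `S`. -/
def opsOf (S : Finset (Label1 ⊕ Label2)) : Set Op2 := (fun a => toOp (vertexOf a)) '' S

theorem toOps_image_vertexOf (S : Finset (Label1 ⊕ Label2)) :
    toOps (vertexOf '' S) = opsOf S := Set.image_image ..

theorem ncard_opsOf (S : Finset (Label1 ⊕ Label2)) : (opsOf S).ncard = S.card := by
  rw [opsOf, Set.ncard_image_of_injective _ toOp_vertexOf_injective, Set.ncard_coe_finset]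

theorem mem_stabOrbit_iff {A : Op2} : A ∈ stabOrbit (vertexOf a) (vertexOf b) ↔
    ∃ γ ∈ implGroup, γ (castV (vtx a)) = castV (vtx a) ∧ opOf (γ (castV (vtx b))) = A := by
  rw [stabOrbit, toOp_vertexOf, toOp_vertexOf]
  constructor
  · rintro ⟨⟨⟨g, hg⟩, hstab⟩, rfl⟩
    obtain ⟨γ, hγ, h⟩ := exists_implements_of_mem_G1 hg
    have hfix : g (opOf (castV (vtx a))) = opOf (castV (vtx a)) := hstab
    rw [h] at hfix
    exact ⟨γ, ⟨hγ, g, hg, h⟩, opOf_injective hfix, (h _).symm⟩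
  · rintro ⟨γ, ⟨-, g, hg, h⟩, hfix, rfl⟩
    refine ⟨⟨⟨g, hg⟩, ?_⟩, h _⟩
    change g (opOf (castV (vtx a))) = opOf (castV (vtx a))
    rw [h, hfix]

theorem exists_maps_of_adj_q0 : ∀ b, Adj (vtx q0) (vtx b) →
    ∃ g : SymCode, g.Maps (vtx q0) (vtx q0) ∧ g.Maps (vtx p0) (vtx b) := by
  decide +kernel

theorem exists_maps_of_adj_p0 : ∀ b, Adj (vtx p0) (vtx b) →
    ∃ g : SymCode, g.Maps (vtx p0) (vtx p0) ∧
      (g.Maps (vtx q0) (vtx b) ∨ g.Maps (vtx p1) (vtx b) ∨ g.Maps (vtx p2) (vtx b)) := by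
  decide +kernel

/-- Representatives of the orbits of ordered pairs of neighbors. -/
def edgeReps : List ((Label1 ⊕ Label2) × (Label1 ⊕ Label2)) :=
  [(q0, p0), (p0, q0), (p0, p1), (p0, p2)]

theorem exists_edgeRep_of_adj (h : Adj (vtx a) (vtx b)) :
    ∃ P ∈ edgeReps, ∃ γ ∈ implGroup,
      γ (castV (vtx P.1)) = castV (vtx a) ∧ γ (castV (vtx P.2)) = castV (vtx b) := by
  obtain ⟨g, a₀, b₀, ha₀, hga, hgb⟩ := exists_toSym_eq a b
  have hg := g.toSym_mem_implGroup
  suffices h : ∃ P ∈ edgeReps, ∃ g' : SymCode,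
      g'.Maps (vtx P.1) (vtx a₀) ∧ g'.Maps (vtx P.2) (vtx b₀) by
    obtain ⟨P, hP, g', hfst, hsnd⟩ := h
    refine ⟨P, hP, g.toSym * g'.toSym, mul_mem hg g'.toSym_mem_implGroup, ?_, ?_⟩
    · rw [LinearEquiv.mul_apply, hfst.toSym_castV, hga]
    · rw [LinearEquiv.mul_apply, hsnd.toSym_castV, hgb]
  rw [adj_iff_of_map hg.1 hga hgb] at h
  rcases ha₀ with rfl | rfl
  · obtain ⟨g', hq0, hp0⟩ := exists_maps_of_adj_q0 b₀ h
    exact ⟨(q0, p0), by simp [edgeReps], g', hq0, hp0⟩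
  · obtain ⟨g', hp0, hq0 | hp1 | hp2⟩ := exists_maps_of_adj_p0 b₀ h
    · exact ⟨(p0, q0), by simp [edgeReps], g', hp0, hq0⟩
    · exact ⟨(p0, p1), by simp [edgeReps], g', hp0, hp1⟩
    · exact ⟨(p0, p2), by simp [edgeReps], g', hp0, hp2⟩

theorem edgeReps_eq_of_dotZ_eq : ∀ P ∈ edgeReps, ∀ Q ∈ edgeReps,
    dotZ (vtx P.2) (vtx P.2) = dotZ (vtx Q.2) (vtx Q.2) →
    dotZ (vtx P.1) (vtx P.1) = dotZ (vtx Q.1) (vtx Q.1) →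
    dotZ (vtx P.1) (vtx P.2) = dotZ (vtx Q.1) (vtx Q.2) →
    vtx P.1 = vtx Q.1 ∧ vtx P.2 = vtx Q.2 := by
  decide +kernel

theorem exists_stabilizer_map_of_adj {c : Label1 ⊕ Label2} (hb : Adj (vtx a) (vtx b))
    (hc : Adj (vtx a) (vtx c)) (hnorm : dotZ (vtx b) (vtx b) = dotZ (vtx c) (vtx c))
    (hdot : dotZ (vtx a) (vtx b) = dotZ (vtx a) (vtx c)) :
    ∃ γ ∈ implGroup, γ (castV (vtx a)) = castV (vtx a) ∧
      γ (castV (vtx b)) = castV (vtx c) := by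
  obtain ⟨P, hP, γ, hγ, hPa, hPb⟩ := exists_edgeRep_of_adj hb
  obtain ⟨Q, hQ, δ, hδ, hQa, hQc⟩ := exists_edgeRep_of_adj hc
  obtain ⟨hfst, hsnd⟩ := edgeReps_eq_of_dotZ_eq P hP Q hQ
    (by rw [← dotZ_eq_of_map hγ.1 hPb hPb, hnorm, dotZ_eq_of_map hδ.1 hQc hQc])
    (by rw [← dotZ_eq_of_map hγ.1 hPa hPa, dotZ_eq_of_map hδ.1 hQa hQa])
    (by rw [← dotZ_eq_of_map hγ.1 hPa hPb, hdot, dotZ_eq_of_map hδ.1 hQa hQc])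
  refine ⟨δ * γ⁻¹, mul_mem hδ (inv_mem hγ), ?_, ?_⟩
  · rw [LinearEquiv.mul_apply, ← hPa, inv_apply_apply, hPa, hfst, hQa]
  · rw [LinearEquiv.mul_apply, ← hPb, inv_apply_apply, hsnd, hQc]

theorem stabOrbit_eq_opsOf (h : Adj (vtx a) (vtx b)) :
    stabOrbit (vertexOf a) (vertexOf b) =
      opsOf (level a (dotZ (vtx b) (vtx b)) (dotZ (vtx a) (vtx b))) := by
  ext A
  rw [mem_stabOrbit_iff]
  constructor
  · rintro ⟨γ, hγ, ha, rfl⟩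
    obtain ⟨c, hc⟩ := exists_map_castV_vtx (inv_mem hγ.1) b
    replace hc : γ (castV (vtx b)) = castV (vtx c) := by rw [← hc, apply_inv_apply]
    refine ⟨c, ?_, ?_⟩
    · exact mem_level.2 ⟨dotZ_eq_of_map hγ.1 hc hc, dotZ_eq_of_map hγ.1 ha hc⟩
    · change toOp (vertexOf c) = _
      rw [toOp_vertexOf, hc]
  · rintro ⟨c, hc, rfl⟩
    obtain ⟨hnorm, hdot⟩ := mem_level.1 hc
    obtain ⟨γ, hγ, ha, hb⟩ :=
      exists_stabilizer_map_of_adj h (adj_of_mem_level h hc) hnorm.symm hdot.symm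
    exact ⟨γ, hγ, ha, by rw [hb, ← toOp_vertexOf]⟩

end StabOrbit

/-! ### Local structure of the graph -/

section LocalStructure

variable {b c : Label1 ⊕ Label2} {n k : ℤ}

theorem dotZ_self_inl : ∀ a, dotZ (vtx (Sum.inl a)) (vtx (Sum.inl a)) = 3 := by decide +kernel

theorem dotZ_self_inr : ∀ a, dotZ (vtx (Sum.inr a)) (vtx (Sum.inr a)) = 5 := by decide +kernel

theorem vertexOf_mem_type1_iff : vertexOf c ∈ Type1 ↔ dotZ (vtx c) (vtx c) = 3 := by
  rw [type1_eq_range, Set.range_comp, vertexOf_injective.mem_set_image]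
  cases c <;> simp [dotZ_self_inl, dotZ_self_inr]

theorem vertexOf_mem_type2_iff : vertexOf c ∈ Type2 ↔ dotZ (vtx c) (vtx c) = 5 := by
  rw [type2_eq_range, Set.range_comp, vertexOf_injective.mem_set_image]
  cases c <;> simp [dotZ_self_inl, dotZ_self_inr]

theorem eq_image_vertexOf {T : Set Vertex} {S : Finset (Label1 ⊕ Label2)}
    (h : ∀ c, vertexOf c ∈ T ↔ c ∈ S) : T = vertexOf '' S := by
  rw [← Set.image_preimage_eq T vertexOf_surjective]
  exact congrArg _ (Set.ext h)

theorem ncard_image_vertexOf (S : Finset (Label1 ⊕ Label2)) : (vertexOf '' S).ncard = S.card := by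
  rw [Set.ncard_image_of_injective _ vertexOf_injective, Set.ncard_coe_finset]

theorem N_inl (a : Label1) : N (vertexOf (Sum.inl a)) = vertexOf '' level (Sum.inl a) 5 2 :=
  eq_image_vertexOf fun _ => mem_N_iff.trans adj_inl_iff

theorem N_inr_inter_type1 (a : Label2) :
    N (vertexOf (Sum.inr a)) ∩ Type1 = vertexOf '' level (Sum.inr a) 3 2 :=
  eq_image_vertexOf fun c => by
    simp only [Set.mem_inter_iff, mem_N_iff, adj_inr_iff, vertexOf_mem_type1_iff,
      Finset.mem_union, mem_level]
    grind

theorem N_inr_inter_type2 (a : Label2) : N (vertexOf (Sum.inr a)) ∩ Type2 =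
    vertexOf '' (level (Sum.inr a) 5 2 ∪ level (Sum.inr a) 5 3 : Finset _) :=
  eq_image_vertexOf fun c => by
    simp only [Set.mem_inter_iff, mem_N_iff, adj_inr_iff, vertexOf_mem_type2_iff,
      Finset.mem_union, mem_level]
    grind

theorem disjoint_level (a : Label1 ⊕ Label2) {k' : ℤ} (h : k ≠ k') :
    Disjoint (level a n k) (level a n k') :=
  Finset.disjoint_left.2 fun _ hk hk' => h ((mem_level.1 hk).2.symm.trans (mem_level.1 hk').2)

theorem stabOrbit_eq_opsOf_level {a : Label1 ⊕ Label2} (hadj : Adj (vtx a) (vtx b))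
    (hb : b ∈ level a n k) : stabOrbit (vertexOf a) (vertexOf b) = opsOf (level a n k) := by
  rw [stabOrbit_eq_opsOf hadj, (mem_level.1 hb).1, (mem_level.1 hb).2]

theorem local_structure_type1 {q : Vertex} (hq : q ∈ Type1) :
    (N q).ncard = 12 ∧ N q ⊆ Type2 ∧ ∀ r ∈ N q, toOps (N q) = stabOrbit q r := by
  obtain ⟨a, rfl⟩ := type1_eq_range.subset hq
  rw [Function.comp_apply, N_inl, ncard_image_vertexOf, card_level_inl, toOps_image_vertexOf]
  refine ⟨rfl, ?_, ?_⟩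
  · rintro _ ⟨c, hc, rfl⟩
    exact vertexOf_mem_type2_iff.2 (mem_level.1 hc).1
  · rintro _ ⟨c, hc, rfl⟩
    exact (stabOrbit_eq_opsOf_level (adj_inl_iff.2 hc) hc).symm

theorem toOps_N_inter_type1 {p r : Vertex} (hp : p ∈ Type2) (hr : r ∈ N p ∩ Type1) :
    toOps (N p ∩ Type1) = stabOrbit p r := by
  obtain ⟨a, rfl⟩ := type2_eq_range.subset hp
  rw [Function.comp_apply, N_inr_inter_type1] at hr ⊢
  obtain ⟨b, hb, rfl⟩ := hr
  rw [toOps_image_vertexOf, stabOrbit_eq_opsOf_level (adj_inr_iff.2 (.inl hb)) hb]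

section TypeTwoNeighbors

variable {a : Label2}

theorem stabOrbit_inr_of_mem_level_two (hb : b ∈ level (Sum.inr a) 5 2) :
    stabOrbit (vertexOf (Sum.inr a)) (vertexOf b) = opsOf (level (Sum.inr a) 5 2) :=
  stabOrbit_eq_opsOf_level (adj_inr_iff.2 (.inr (Finset.mem_union_left _ hb))) hb

theorem stabOrbit_inr_of_mem_level_three (hc : c ∈ level (Sum.inr a) 5 3) :
    stabOrbit (vertexOf (Sum.inr a)) (vertexOf c) = opsOf (level (Sum.inr a) 5 3) :=
  stabOrbit_eq_opsOf_level (adj_inr_iff.2 (.inr (Finset.mem_union_right _ hc))) hc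

theorem disjoint_stabOrbit_inr (hb : b ∈ level (Sum.inr a) 5 2)
    (hc : c ∈ level (Sum.inr a) 5 3) :
    Disjoint (stabOrbit (vertexOf (Sum.inr a)) (vertexOf b))
      (stabOrbit (vertexOf (Sum.inr a)) (vertexOf c)) := by
  rw [stabOrbit_inr_of_mem_level_two hb, stabOrbit_inr_of_mem_level_three hc, opsOf, opsOf,
    Set.disjoint_image_iff toOp_vertexOf_injective]
  exact Finset.disjoint_coe.2 (disjoint_level _ (by norm_num))

theorem toOps_N_inr_inter_type2 (hb : b ∈ level (Sum.inr a) 5 2)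
    (hc : c ∈ level (Sum.inr a) 5 3) :
    toOps (N (vertexOf (Sum.inr a)) ∩ Type2) =
      stabOrbit (vertexOf (Sum.inr a)) (vertexOf b) ∪
        stabOrbit (vertexOf (Sum.inr a)) (vertexOf c) := by
  rw [N_inr_inter_type2, toOps_image_vertexOf, stabOrbit_inr_of_mem_level_two hb,
    stabOrbit_inr_of_mem_level_three hc, opsOf, Finset.coe_union, Set.image_union, opsOf, opsOf]

end TypeTwoNeighbors

theorem local_structure_type2 {p : Vertex} (hp : p ∈ Type2) :
    (N p ∩ Type1).ncard = 8 ∧ (∀ r ∈ N p ∩ Type1, toOps (N p ∩ Type1) = stabOrbit p r) ∧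
      (N p ∩ Type2).ncard = 16 ∧
      ∃ r₁ ∈ N p ∩ Type2, ∃ r₂ ∈ N p ∩ Type2,
        (stabOrbit p r₁).ncard = 8 ∧ (stabOrbit p r₂).ncard = 8 ∧
        Disjoint (stabOrbit p r₁) (stabOrbit p r₂) ∧
        toOps (N p ∩ Type2) = stabOrbit p r₁ ∪ stabOrbit p r₂ := by
  obtain ⟨a, rfl⟩ := type2_eq_range.subset hp
  rw [Function.comp_apply] at hp ⊢
  obtain ⟨h32, h52, h53⟩ := card_level_inr a
  obtain ⟨b, hb⟩ : (level (Sum.inr a) 5 2).Nonempty := Finset.card_pos.1 (by rw [h52]; norm_num)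
  obtain ⟨c, hc⟩ : (level (Sum.inr a) 5 3).Nonempty := Finset.card_pos.1 (by rw [h53]; norm_num)
  refine ⟨?_, fun r hr => toOps_N_inter_type1 hp hr, ?_, vertexOf b, ?_, vertexOf c, ?_, ?_, ?_,
    disjoint_stabOrbit_inr hb hc, toOps_N_inr_inter_type2 hb hc⟩
  · rw [N_inr_inter_type1, ncard_image_vertexOf, h32]
  · rw [N_inr_inter_type2, ncard_image_vertexOf,
      Finset.card_union_of_disjoint (disjoint_level _ (by norm_num)), h52, h53]
  · exact (N_inr_inter_type2 a).superset ⟨b, Finset.mem_union_left _ hb, rfl⟩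
  · exact (N_inr_inter_type2 a).superset ⟨c, Finset.mem_union_right _ hc, rfl⟩
  · rw [stabOrbit_inr_of_mem_level_two hb, ncard_opsOf, h52]
  · rw [stabOrbit_inr_of_mem_level_three hc, ncard_opsOf, h53]

end LocalStructure

/-! ### The operators of the representatives -/

section Representatives

theorem toOp_vertexOf_of_entries {l : Label1 ⊕ Label2} {a b c d e f g h i : ℤ}
    (hl : ∀ m, vtx l m = !![a, b, c; d, e, f; g, h, i] m.1 m.2) :
    toOp (vertexOf l) = (1 / 4 : ℂ) • (1 +
      ((a : ℂ) • X ⊗ₖ X + (b : ℂ) • Y ⊗ₖ Z + (c : ℂ) • Z ⊗ₖ Y +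
      ((d : ℂ) • Z ⊗ₖ Z + (e : ℂ) • X ⊗ₖ Y + (f : ℂ) • Y ⊗ₖ X) +
      ((g : ℂ) • Y ⊗ₖ Y + (h : ℂ) • Z ⊗ₖ X + (i : ℂ) • X ⊗ₖ Z))) := by
  simp [toOp_vertexOf, opOf, castV, hl, Fintype.sum_prod_type, Fin.sum_univ_three, pauliSquare]

theorem toOp_q0 : toOp (vertexOf q0) = (1 / 4 : ℂ) • (1 + X ⊗ₖ Y - Y ⊗ₖ Y + Z ⊗ₖ Y) := by
  have h : ∀ m, vtx q0 m = !![0, 0, 1; 0, 1, 0; -1, 0, 0] m.1 m.2 := by decide +kernel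
  rw [toOp_vertexOf_of_entries h]
  push_cast
  module

theorem toOp_q1 : toOp (vertexOf q1) = (1 / 4 : ℂ) • (1 + Z ⊗ₖ X - Z ⊗ₖ Y + Z ⊗ₖ Z) := by
  have h : ∀ m, vtx q1 m = !![0, 0, -1; 1, 0, 0; 0, 1, 0] m.1 m.2 := by decide +kernel
  rw [toOp_vertexOf_of_entries h]
  push_cast
  module

theorem toOp_p0 : toOp (vertexOf p0) =
    (1 / 4 : ℂ) • (1 + X ⊗ₖ X + X ⊗ₖ Y + Y ⊗ₖ X - Y ⊗ₖ Y + Z ⊗ₖ Z) := by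
  have h : ∀ m, vtx p0 m = !![1, 0, 0; 1, 1, 1; -1, 0, 0] m.1 m.2 := by decide +kernel
  rw [toOp_vertexOf_of_entries h]
  push_cast
  module

theorem toOp_p1 : toOp (vertexOf p1) =
    (1 / 4 : ℂ) • (1 + X ⊗ₖ X + X ⊗ₖ Y - Y ⊗ₖ Z + Z ⊗ₖ X - Z ⊗ₖ Y) := by
  have h : ∀ m, vtx p1 m = !![1, -1, -1; 0, 1, 0; 0, 1, 0] m.1 m.2 := by decide +kernel
  rw [toOp_vertexOf_of_entries h]
  push_cast
  module

theorem toOp_p2 : toOp (vertexOf p2) =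
    (1 / 4 : ℂ) • (1 + X ⊗ₖ X - Y ⊗ₖ Y - Y ⊗ₖ Z - Z ⊗ₖ Y + Z ⊗ₖ Z) := by
  have h : ∀ m, vtx p2 m = !![1, -1, -1; 1, 0, 0; -1, 0, 0] m.1 m.2 := by decide +kernel
  rw [toOp_vertexOf_of_entries h]
  push_cast
  module

theorem exists_loop_p0_q1 : ∃ (L : Finset Meas) (φ : {m : Meas // m ∈ L} → ℤˣ), IsLoop L ∧
    (vertexOf p0 : Dist) + (1 / 2 : ℝ) • loopDir L φ = (vertexOf q1 : Dist) := by
  have h : IsLoopVec (vtx q1 - vtx p0) := isLoopVec_vtx_sub (by decide +kernel) (by decide +kernel)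
  exact ⟨_, _, h.isLoop, distOf_add_half_smul_loopDir h⟩

theorem representatives : ∃ q₀ p₀ p₁ p₂ q₁ : Vertex,
    toOp q₀ = (1 / 4 : ℂ) • (1 + X ⊗ₖ Y - Y ⊗ₖ Y + Z ⊗ₖ Y) ∧
    toOp p₀ = (1 / 4 : ℂ) • (1 + X ⊗ₖ X + X ⊗ₖ Y + Y ⊗ₖ X - Y ⊗ₖ Y + Z ⊗ₖ Z) ∧
    toOp p₁ = (1 / 4 : ℂ) • (1 + X ⊗ₖ X + X ⊗ₖ Y - Y ⊗ₖ Z + Z ⊗ₖ X - Z ⊗ₖ Y) ∧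
    toOp p₂ = (1 / 4 : ℂ) • (1 + X ⊗ₖ X - Y ⊗ₖ Y - Y ⊗ₖ Z - Z ⊗ₖ Y + Z ⊗ₖ Z) ∧
    toOp q₁ = (1 / 4 : ℂ) • (1 + Z ⊗ₖ X - Z ⊗ₖ Y + Z ⊗ₖ Z) ∧
    q₀ ∈ Type1 ∧ p₀ ∈ Type2 ∧ p₁ ∈ Type2 ∧ p₂ ∈ Type2 ∧ q₁ ∈ Type1 ∧
    toOps (N q₀) = stabOrbit q₀ p₀ ∧
    toOps (N p₀ ∩ Type1) = stabOrbit p₀ q₀ ∧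
    toOps (N p₀ ∩ Type2) = stabOrbit p₀ p₁ ∪ stabOrbit p₀ p₂ ∧
    Disjoint (stabOrbit p₀ p₁) (stabOrbit p₀ p₂) ∧
    q₁ ∉ N p₀ ∧
    ∃ (L : Finset Meas) (φ : {m : Meas // m ∈ L} → ℤˣ), IsLoop L ∧
      (p₀ : Dist) + (1 / 2 : ℝ) • loopDir L φ = (q₁ : Dist) := by
  have hq0 : vertexOf q0 ∈ Type1 := vertexOf_mem_type1_iff.2 (dotZ_self_inl _)
  have hp0 : vertexOf p0 ∈ Type2 := vertexOf_mem_type2_iff.2 (dotZ_self_inr _)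
  have hp1 : p1 ∈ level p0 5 2 := mem_level.2 (by decide +kernel)
  have hp2 : p2 ∈ level p0 5 3 := mem_level.2 (by decide +kernel)
  have hq0p0 : vertexOf p0 ∈ N (vertexOf q0) := mem_N_iff.2 (by decide +kernel)
  have hp0q0 : vertexOf q0 ∈ N (vertexOf p0) := mem_N_iff.2 (by decide +kernel)
  have hq1 : vertexOf q1 ∉ N (vertexOf p0) := mem_N_iff.not.2 (by decide +kernel)
  exact ⟨vertexOf q0, vertexOf p0, vertexOf p1, vertexOf p2, vertexOf q1,
    toOp_q0, toOp_p0, toOp_p1, toOp_p2, toOp_q1, hq0, hp0,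
    vertexOf_mem_type2_iff.2 (mem_level.1 hp1).1, vertexOf_mem_type2_iff.2 (mem_level.1 hp2).1,
    vertexOf_mem_type1_iff.2 (dotZ_self_inl _),
    (local_structure_type1 hq0).2.2 _ hq0p0, toOps_N_inter_type1 hp0 ⟨hp0q0, hq0⟩,
    toOps_N_inr_inter_type2 hp1 hp2, disjoint_stabOrbit_inr hp1 hp2, hq1, exists_loop_p0_q1⟩

end Representatives

end Mermin

end

open Mermin in
open scoped Kronecker in
theorem theorem2 :
    -- the graph of `MP_0` is the complete graph on 16 vertices
    Nonempty (polytopeGraph (MP beta0) ≃g (⊤ : SimpleGraph (Fin 16))) ∧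
    -- points of `MP_1` are identified with operators, on which `G_1` acts
    (Set.InjOn toOp (MP beta1) ∧ ∀ g ∈ G1, g '' (toOp '' MP beta1) = toOp '' MP beta1) ∧
    -- the vertices of `MP_1`
    (Nat.card Vertex = 120 ∧ Type1.ncard = 48 ∧ Type2.ncard = 72 ∧
      Disjoint Type1 Type2 ∧ Type1 ∪ Type2 = Set.univ) ∧
    -- the edges of `MP_1` are given by signed loops
    (∀ q₁ q₂ : Vertex, q₂ ∈ N q₁ →
      ∃ (L : Finset Meas) (φ : {m : Meas // m ∈ L} → ℤˣ), IsLoop L ∧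
        segment ℝ (q₁ : Dist) (q₂ : Dist) =
          (fun α : ℝ => (q₁ : Dist) + α • loopDir L φ) '' Set.Icc 0 (1 / 2) ∧
        (q₁ : Dist) + (1 / 2 : ℝ) • loopDir L φ = (q₂ : Dist)) ∧
    -- local structure at the vertices of type 1
    (∀ q ∈ Type1, (N q).ncard = 12 ∧ N q ⊆ Type2 ∧
      ∀ r ∈ N q, toOps (N q) = stabOrbit q r) ∧
    -- local structure at the vertices of type 2
    (∀ p ∈ Type2,
      (N p ∩ Type1).ncard = 8 ∧ (∀ r ∈ N p ∩ Type1, toOps (N p ∩ Type1) = stabOrbit p r) ∧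
      (N p ∩ Type2).ncard = 16 ∧
      ∃ r₁ ∈ N p ∩ Type2, ∃ r₂ ∈ N p ∩ Type2,
        (stabOrbit p r₁).ncard = 8 ∧ (stabOrbit p r₂).ncard = 8 ∧
        Disjoint (stabOrbit p r₁) (stabOrbit p r₂) ∧
        toOps (N p ∩ Type2) = stabOrbit p r₁ ∪ stabOrbit p r₂) ∧
    -- representatives of the orbits, and a vertex on a signed loop that is not a neighbor
    (∃ q₀ p₀ p₁ p₂ q₁ : Vertex,
      toOp q₀ = (1 / 4 : ℂ) • (1 + X ⊗ₖ Y - Y ⊗ₖ Y + Z ⊗ₖ Y) ∧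
      toOp p₀ = (1 / 4 : ℂ) • (1 + X ⊗ₖ X + X ⊗ₖ Y + Y ⊗ₖ X - Y ⊗ₖ Y + Z ⊗ₖ Z) ∧
      toOp p₁ = (1 / 4 : ℂ) • (1 + X ⊗ₖ X + X ⊗ₖ Y - Y ⊗ₖ Z + Z ⊗ₖ X - Z ⊗ₖ Y) ∧
      toOp p₂ = (1 / 4 : ℂ) • (1 + X ⊗ₖ X - Y ⊗ₖ Y - Y ⊗ₖ Z - Z ⊗ₖ Y + Z ⊗ₖ Z) ∧
      toOp q₁ = (1 / 4 : ℂ) • (1 + Z ⊗ₖ X - Z ⊗ₖ Y + Z ⊗ₖ Z) ∧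
      q₀ ∈ Type1 ∧ p₀ ∈ Type2 ∧ p₁ ∈ Type2 ∧ p₂ ∈ Type2 ∧ q₁ ∈ Type1 ∧
      toOps (N q₀) = stabOrbit q₀ p₀ ∧
      toOps (N p₀ ∩ Type1) = stabOrbit p₀ q₀ ∧
      toOps (N p₀ ∩ Type2) = stabOrbit p₀ p₁ ∪ stabOrbit p₀ p₂ ∧
      Disjoint (stabOrbit p₀ p₁) (stabOrbit p₀ p₂) ∧
      q₁ ∉ N p₀ ∧
      ∃ (L : Finset Meas) (φ : {m : Meas // m ∈ L} → ℤˣ), IsLoop L ∧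
        (p₀ : Dist) + (1 / 2 : ℝ) • loopDir L φ = (q₁ : Dist)) := by
  exact ⟨polytopeGraph_MP_beta0, ⟨injOn_toOp, fun _ hg => G1_image_toOp hg⟩,
    ⟨card_vertex, ncard_type1, ncard_type2, disjoint_type1_type2, type1_union_type2⟩,
    fun _ _ h => exists_loop_of_mem_N h, fun _ hq => local_structure_type1 hq,
    fun _ hp => local_structure_type2 hp, representatives⟩
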